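/- Let $S_\infty$ be the group of all permutations of $\mathbb N$ with the topology of pointwise convergence, let $G\le S_\infty$ be a closed subgroup, and let $X$ be a Polish $G$-space, i.e. a Polish space with a continuous action of $G$. Fix a countable basis $\mathcal A=\{A_l: l\in\mathbb N\}$ of $X$ and a point $x\in X$. Let $S^G_{<\infty}$ be the set of all restrictions $f|_d$ with $f\in G$ and $d\subseteq\mathbb N$ finite. For $\sigma\in S^G_{<\infty}$ put $V^G_\sigma=\{f\in G: f\supseteq\sigma\}$, and for finite $c\subseteq\mathbb N$ let $V^G_c$ be the group of all $f\in G$ that fix every element of $c$. For $\sigma\in S^G_{<\infty}$ with domain $d$ and range $c$, and for ordinals $0<\alpha<\omega_1$, define by recursion $$B_1(x,\sigma)=\bigcap\{V^G_cA_l: V^G_\sigma x\cap A_l\neq\emptyset\}\cap\bigcap\{X\setminus V^G_cA_l: V^G_\sigma x\cap A_l=\emptyset\},$$ $$B_{\alpha+1}(x,\sigma)=\bigcap_{b\supseteq d}\ \bigcup_{\sigma'\supseteq\sigma,\ \mathrm{dom}\,\sigma'=b}B_\alpha(x,\sigma')\ \cap\ \bigcap_{a\supseteq c}\ \bigcup_{\sigma'\supseteq\sigma,\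 \mathrm{rng}\,\sigma'=a}B_\alpha(x,\sigma'),$$ where $a,b$ range over finite subsets of $\mathbb N$ and $\sigma'$ over $S^G_{<\infty}$, and $B_\lambda(x,\sigma)=\bigcap_{0<\alpha<\lambda}B_\alpha(x,\sigma)$ for limit $\lambda$. Let $t^x_\alpha$ be the relative topology on $B_\alpha(x,\emptyset)$ generated by the sets in $\mathcal A$ and the sets $B_\beta(x,\sigma)$ with $0<\beta<\alpha$ and $\sigma\in S^G_{<\infty}$. (The orbit $Gx$ is contained in every $B_\alpha(x,\emptyset)$.) Let $0<\alpha<\omega_1$. (a) If $Gx\in\mathbf\Pi^0_{\alpha+1}(X)$, then (i) $Gx$ is non-meager in $B_\alpha(x,\emptyset)$ with respect to $t^x_\alpha$; (ii) the map $G\to Gx$, $g\mapsto gx$, is open when $Gx$ carries the subspace topology from $t^x_\alpha$; (iii) $Gx=B_{\alpha+1}(x,\emptyset)$. (b) If $\alpha$ is a limit ordinal and $Gx\in\mathbf\Pi^0_\alpha(X)$, then (iv) $Gx=B_\alpha(x,\emptyset)$; (v) the map $G\to Gx$, $g\mapsto gx$, is open when $Gx$ carries the subspace topology from $t^x_\alpha$.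 -/

import Mathlib

noncomputable section

open scoped Pointwise

/-- The topology of `S_∞`, the group of all permutations of `ℕ`: pointwise convergence, i.e. the
subspace topology inherited from the Baire space `ℕ → ℕ`. -/
instance permNatTopology : TopologicalSpace (Equiv.Perm ℕ) :=
  TopologicalSpace.induced (fun f => (f : ℕ → ℕ)) inferInstance

namespace AlphaSets

/-! ### The Borel hierarchy -/

/-- `IsSigma0 α S`: the set `S` is `𝚺⁰_α`. The `𝚺⁰_1` sets are the open sets; for `α > 1` the
`𝚺⁰_α` sets are the countable unions of sets whose complements are `𝚺⁰_β` for some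
`1 ≤ β < α` (which may vary with the set). -/
inductive IsSigma0 {X : Type*} [TopologicalSpace X] : Ordinal.{0} → Set X → Prop
  | of_isOpen (U : Set X) (hU : IsOpen U) : IsSigma0 1 U
  | iUnion (α : Ordinal.{0}) (hα : 1 < α) (β : ℕ → Ordinal.{0}) (hβ : ∀ n, 1 ≤ β n ∧ β n < α)
      (S : ℕ → Set X) (hS : ∀ n, IsSigma0 (β n) (S n)ᶜ) : IsSigma0 α (⋃ n, S n)

/-- `IsPi0 α S`: the set `S` is `𝚷⁰_α`, i.e. its complement is `𝚺⁰_α`. -/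
def IsPi0 {X : Type*} [TopologicalSpace X] (α : Ordinal.{0}) (S : Set X) : Prop :=
  IsSigma0 α Sᶜ

/-! ### Finite partial bijections -/

/-- The domain of a partial bijection. -/
def pdom (σ : ℕ ≃. ℕ) : Set ℕ := {k | ∃ m, m ∈ σ k}

/-- The range of a partial bijection. -/
def prng (σ : ℕ ≃. ℕ) : Set ℕ := {m | ∃ k, m ∈ σ k}

open Classical in
/-- The restriction `f|_d` of a permutation to a finite set `d`. -/
def restrict (f : Equiv.Perm ℕ) (d : Finset ℕ) : ℕ ≃. ℕ :=
  (PEquiv.ofSet (d : Set ℕ)).trans f.toPEquiv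

variable (G : Subgroup (Equiv.Perm ℕ))

/-- `S_{<∞}^G`: the restrictions of the elements of `G` to finite sets of natural numbers. -/
def finPartial : Set (ℕ ≃. ℕ) := {σ | ∃ f ∈ G, ∃ d : Finset ℕ, σ = restrict f d}

/-- `V_σ^G`: the elements of `G` that extend `σ`. -/
def extending (σ : ℕ ≃. ℕ) : Set G := {g | σ ≤ (g : Equiv.Perm ℕ).toPEquiv}

/-- `V_c^G`: the elements of `G` that fix every element of `c`. -/
def fixing (c : Set ℕ) : Set G := {g | ∀ k ∈ c, (g : Equiv.Perm ℕ) k = k}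

/-! ### The `α`-sets -/

variable {X : Type*} [MulAction G X] (A : ℕ → Set X) (x : X)

/-- `B_1(x, σ)`. -/
def alphaSetOne (σ : ℕ ≃. ℕ) : Set X :=
  {y | ∀ l, (((fun g : G => g • x) '' extending G σ) ∩ A l).Nonempty →
    y ∈ fixing G (prng σ) • A l} ∩
  {y | ∀ l, ((fun g : G => g • x) '' extending G σ) ∩ A l = ∅ →
    y ∉ fixing G (prng σ) • A l}

/-- `B_{α+1}(x, σ)` in terms of the sets `B σ' = B_α(x, σ')`. -/
def alphaSetSucc (B : (ℕ ≃. ℕ) → Set X) (σ : ℕ ≃. ℕ) : Set X :=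
  {y | ∀ b : Finset ℕ, pdom σ ⊆ b →
    ∃ σ' ∈ finPartial G, σ ≤ σ' ∧ pdom σ' = b ∧ y ∈ B σ'} ∩
  {y | ∀ a : Finset ℕ, prng σ ⊆ a →
    ∃ σ' ∈ finPartial G, σ ≤ σ' ∧ prng σ' = a ∧ y ∈ B σ'}

open Classical in
/-- The set `B_α(x, σ)`, by recursion on the ordinal `α > 0`, relative to the basis
`{A_l : l ∈ ℕ}` of `X`. The value at `α = 0`, where the notion is not defined, is the whole
space. -/
def alphaSet (α : Ordinal.{0}) : (ℕ ≃. ℕ) → Set X :=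
  Ordinal.limitRecOn (motive := fun _ => (ℕ ≃. ℕ) → Set X) α
    (fun _ => Set.univ)
    (fun β B => if β = 0 then alphaSetOne G A x else alphaSetSucc G B)
    (fun lam _ B σ => ⋂ (β : Ordinal.{0}) (hβ : β < lam), B β hβ σ)

lemma alphaSet_zero (σ : ℕ ≃. ℕ) : alphaSet G A x 0 σ = Set.univ := by
  simp [alphaSet]

lemma alphaSet_one (σ : ℕ ≃. ℕ) : alphaSet G A x 1 σ = alphaSetOne G A x σ := by
  have h := Ordinal.limitRecOn_add_one (motive := fun _ => (ℕ ≃. ℕ) → Set X) 0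
    (fun _ => Set.univ)
    (fun β B => if β = 0 then alphaSetOne G A x else alphaSetSucc G B)
    (fun lam _ B σ => ⋂ (β : Ordinal.{0}) (hβ : β < lam), B β hβ σ)
  rw [zero_add, if_pos rfl] at h
  exact congrFun h σ

lemma alphaSet_add_one {α : Ordinal.{0}} (hα : 0 < α) (σ : ℕ ≃. ℕ) :
    alphaSet G A x (α + 1) σ = alphaSetSucc G (alphaSet G A x α) σ := by
  unfold alphaSet
  rw [Ordinal.limitRecOn_add_one, if_neg hα.ne']

lemma alphaSet_limit {lam : Ordinal.{0}} (h : Order.IsSuccLimit lam) (σ : ℕ ≃. ℕ) :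
    alphaSet G A x lam σ = ⋂ (β : Ordinal.{0}) (_ : 0 < β ∧ β < lam), alphaSet G A x β σ := by
  have h1 : alphaSet G A x lam σ = ⋂ (β : Ordinal.{0}) (_ : β < lam), alphaSet G A x β σ := by
    unfold alphaSet
    rw [Ordinal.limitRecOn_limit _ _ _ _ h]
  rw [h1]
  ext y
  simp only [Set.mem_iInter]
  refine ⟨fun hy β hβ => hy β hβ.2, fun hy β hβ => ?_⟩
  rcases eq_or_ne β 0 with rfl | h0
  · simp [alphaSet_zero]
  · exact hy β ⟨pos_iff_ne_zero.2 h0, hβ⟩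

/-! ### The topology `t^x_α` -/

open Classical in
/-- `𝓑^x_β`: the basis `{A_l}` for `β = 0`, and `{B_β(x, σ) : σ ∈ S_{<∞}^G}` for `β > 0`. -/
def levelFamily (β : Ordinal.{0}) : Set (Set X) :=
  if β = 0 then Set.range A else {S | ∃ σ ∈ finPartial G, S = alphaSet G A x β σ}

/-- `𝓑^x_{<α}`. -/
def earlierFamily (α : Ordinal.{0}) : Set (Set X) :=
  ⋃ (β : Ordinal.{0}) (_ : β < α), levelFamily G A x β

/-- `t^x_α`: the relative topology on `B_α(x, ∅)` generated by `𝓑^x_{<α}`. -/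
@[reducible] def alphaTopology (α : Ordinal.{0}) : TopologicalSpace (alphaSet G A x α ⊥) :=
  TopologicalSpace.induced Subtype.val (TopologicalSpace.generateFrom (earlierFamily G A x α))

/-! ### The orbit lies in `B_α(x, ∅)` -/

lemma mem_restrict {f : Equiv.Perm ℕ} {d : Finset ℕ} {k m : ℕ} :
    m ∈ restrict f d k ↔ k ∈ d ∧ f k = m := by
  unfold restrict
  rw [PEquiv.mem_trans]
  constructor
  · rintro ⟨j, hj, hm⟩
    rw [PEquiv.mem_ofSet_iff] at hj
    obtain ⟨rfl, hj⟩ := hj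
    exact ⟨by simpa using hj, by simpa [Equiv.toPEquiv_apply] using hm⟩
  · rintro ⟨hk, rfl⟩
    exact ⟨k, PEquiv.mem_ofSet_iff.2 ⟨rfl, by simpa using hk⟩, by simp [Equiv.toPEquiv_apply]⟩

lemma mem_extending {σ : ℕ ≃. ℕ} {g : G} :
    g ∈ extending G σ ↔ ∀ k m, m ∈ σ k → (g : Equiv.Perm ℕ) k = m := by
  simp [extending, PEquiv.le_def, Equiv.toPEquiv_apply]

lemma bot_mem_finPartial : (⊥ : ℕ ≃. ℕ) ∈ finPartial G := by
  refine ⟨1, G.one_mem, ∅, ?_⟩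
  apply PEquiv.ext
  intro k
  refine Option.ext fun m => ?_
  change m ∈ (⊥ : ℕ ≃. ℕ) k ↔ m ∈ restrict 1 ∅ k
  rw [mem_restrict]
  simp

lemma smul_mem_alphaSet (α : Ordinal.{0}) :
    ∀ (σ : ℕ ≃. ℕ) (g : G), g ∈ extending G σ → g • x ∈ alphaSet G A x α σ := by
  induction α using Ordinal.limitRecOn with
  | zero => intro σ g _; simp [alphaSet_zero]
  | add_one α ih =>
    intro σ g hg
    have hg' := (mem_extending G).1 hg
    rcases eq_or_ne α 0 with rfl | h0
    · rw [zero_add, alphaSet_one]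
      refine ⟨?_, ?_⟩
      · rintro l ⟨_, ⟨h, hh, rfl⟩, hl⟩
        have hh' := (mem_extending G).1 hh
        refine ⟨g * h⁻¹, ?_, h • x, hl, by simp [mul_smul]⟩
        rintro m ⟨k, hk⟩
        have e : (h : Equiv.Perm ℕ).symm m = k := by
          rw [← hh' k m hk]; simp
        have e' : ((g * h⁻¹ : G) : Equiv.Perm ℕ) m = (g : Equiv.Perm ℕ) ((h : Equiv.Perm ℕ).symm m) := rfl
        rw [e', e, hg' k m hk]
      · rintro l hl ⟨v, hv, z, hz, hvz⟩
        have hvz' : v • z = g • x := hvz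
        refine (Set.eq_empty_iff_forall_notMem.1 hl) z ⟨⟨v⁻¹ * g, ?_, ?_⟩, hz⟩
        · rw [mem_extending]
          intro k m hk
          have e := hv m ⟨k, hk⟩
          have e' : ((v⁻¹ * g : G) : Equiv.Perm ℕ) k =
              (v : Equiv.Perm ℕ).symm ((g : Equiv.Perm ℕ) k) := rfl
          rw [e', hg' k m hk, Equiv.symm_apply_eq, e]
        · change (v⁻¹ * g) • x = z
          rw [mul_smul, ← hvz', inv_smul_smul]
    · rw [alphaSet_add_one G A x (pos_iff_ne_zero.2 h0)]
      refine ⟨?_, ?_⟩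
      · intro b hb
        refine ⟨restrict g b, ⟨g, g.2, b, rfl⟩, ?_, ?_, ih _ g ?_⟩
        · intro k m hk
          exact mem_restrict.2 ⟨by simpa using hb ⟨m, hk⟩, hg' k m hk⟩
        · ext k
          exact ⟨fun ⟨m, hm⟩ => (mem_restrict.1 hm).1, fun hk => ⟨_, mem_restrict.2 ⟨hk, rfl⟩⟩⟩
        · rw [mem_extending]
          intro k m hk
          exact (mem_restrict.1 hk).2
      · intro a ha
        refine ⟨restrict g (a.image (g : Equiv.Perm ℕ).symm), ⟨g, g.2, _, rfl⟩, ?_, ?_, ih _ g ?_⟩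
        · intro k m hk
          refine mem_restrict.2 ⟨Finset.mem_image.2 ⟨m, by simpa using ha ⟨k, hk⟩, ?_⟩, hg' k m hk⟩
          rw [← hg' k m hk]; simp
        · ext m
          constructor
          · rintro ⟨k, hk⟩
            obtain ⟨hd, rfl⟩ := mem_restrict.1 hk
            obtain ⟨j, hj, rfl⟩ := Finset.mem_image.1 hd
            simpa using hj
          · intro hm
            exact ⟨(g : Equiv.Perm ℕ).symm m,
              mem_restrict.2 ⟨Finset.mem_image.2 ⟨m, by simpa using hm, rfl⟩, by simp⟩⟩
        · rw [mem_extending]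
          intro k m hk
          exact (mem_restrict.1 hk).2
  | limit lam hlam ih =>
    intro σ g hg
    rw [alphaSet_limit G A x hlam]
    simp only [Set.mem_iInter]
    exact fun β hβ => ih β hβ.2 σ g hg

lemma orbit_subset_alphaSet (α : Ordinal.{0}) :
    MulAction.orbit G x ⊆ alphaSet G A x α ⊥ := by
  rintro _ ⟨g, rfl⟩
  exact smul_mem_alphaSet G A x α ⊥ g ((mem_extending G).2 (by simp))

/-- The topology on the orbit `Gx` as a subspace of `B_α(x, ∅)` with `t^x_α`. -/
@[reducible] def orbitTopology (α : Ordinal.{0}) : TopologicalSpace (MulAction.orbit G x) :=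
  TopologicalSpace.induced (Set.inclusion (orbit_subset_alphaSet G A x α))
    (alphaTopology G A x α)

/-- The orbit map `G → Gx`, `g ↦ gx`. -/
def orbitMap (g : G) : MulAction.orbit G x := ⟨g • x, MulAction.mem_orbit x g⟩

end AlphaSets

end

/-!
# Orbits as `α`-sets

The sets `B_β(x, f|_d)` are classes of a symmetric relation: `y ∈ B_β(x, f|_d)` holds exactly if
`f x` and `y` are equivalent of rank `β` over the finite set `f(d)` (`BackForth`,
`mem_alphaSet_iff`). In rank `1` the relation compares the closures of `V_c z` and `V_c y`, and
higher ranks are obtained by back-and-forth. It is an equivalence relation, it is invariant under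
the action of `G`, and it is decreasing in the rank and in the finite set.

Points equivalent of rank `β` over `c` lie in the same Vaught transforms `C^{Δ V_c}` of `𝚺⁰_β` sets
`C` (`BackForth.meagrelyMeets_iff`). An invariant `𝚷⁰_β` set is its own Vaught transform, hence a
`𝚷⁰_β` orbit is a single class of rank `β` over `∅`, namely `B_β(x, ∅)` (`orbit_eq_alphaSet`).

For the topological assertions, choose a dense sequence `(g_n)` in `G` and attach to each point
`y` of `B_α(x, ∅)` its codes: for each positive `γ < α` and each finite `a`, the first `n` such
that `g_n x` and `y` are equivalent of rank `γ` over `a`. The topology `t^x_α` is the one that makes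
`y ↦ (y, codes of y)` an embedding into `X × ℕ^J` with `J` countable, and the image is `G_δ`, since
apart from rank `1` conditions on `y` it is described by conditions on the codes alone. Therefore
`t^x_α` is Polish (`AlphaSpace.polishSpace`). The orbit of `x` is dense in it. On `B_α(x, ∅)` the
Vaught transforms of `𝚺⁰_β` sets with `β ≤ α` are `t^x_α`-open (`AlphaSpace.isOpen_vaught`), so a
`𝚷⁰_{α+1}` orbit is `G_δ`. Being a dense `G_δ` set, it is non-meagre; being a Polish space on which
`G` acts transitively and continuously, it has open orbit maps by Effros' theorem
(`isOpen_orbit_of_isOpen`). A `𝚷⁰_α` orbit with `α` a limit is also `𝚷⁰_{α+1}`, which gives the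
remaining assertion.
-/

noncomputable section

open scoped Pointwise

namespace AlphaSets

open Set Filter Topology TopologicalSpace

/-! ### Non-archimedean Polish groups of permutations -/

section

lemma continuous_perm_apply (k : ℕ) : Continuous fun f : Equiv.Perm ℕ => f k :=
  (continuous_apply k).comp continuous_induced_dom

lemma continuous_perm_eval : Continuous fun p : Equiv.Perm ℕ × ℕ => p.1 p.2 :=
  continuous_prod_of_discrete_right.2 continuous_perm_apply

lemma continuous_perm_iff {Y : Type*} [TopologicalSpace Y] {F : Y → Equiv.Perm ℕ} :
    Continuous F ↔ ∀ k, Continuous fun y => F y k :=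
  continuous_induced_rng.trans continuous_pi_iff

instance : IsTopologicalGroup (Equiv.Perm ℕ) where
  continuous_mul := continuous_perm_iff.2 fun k =>
    continuous_perm_eval.comp
      (continuous_fst.prodMk ((continuous_perm_apply k).comp continuous_snd))
  continuous_inv := continuous_perm_iff.2 fun k => continuous_discrete_rng.2 fun m => by
    have : (fun f : Equiv.Perm ℕ => f⁻¹ k) ⁻¹' {m} = (fun f : Equiv.Perm ℕ => f m) ⁻¹' {k} := by
      ext f
      exact Equiv.Perm.inv_eq_iff_eq.trans eq_comm
    rw [this]
    exact (isOpen_discrete _).preimage (continuous_perm_apply m)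

/-- A permutation is coded by itself together with its inverse; the codes form a closed subset
of `(ℕ → ℕ) × (ℕ → ℕ)`, whereas the permutations alone are only a `G_δ` subset of `ℕ → ℕ`. -/
instance : PolishSpace (Equiv.Perm ℕ) := by
  let F : Equiv.Perm ℕ → (ℕ → ℕ) × (ℕ → ℕ) := fun f => (f, (f⁻¹ : Equiv.Perm ℕ))
  have hc : Continuous F :=
    continuous_induced_dom.prodMk (continuous_induced_dom.comp continuous_inv)
  have hind : IsInducing F := by
    refine IsInducing.of_comp hc continuous_fst ⟨rfl⟩
  have hinj : Function.Injective F := fun f g h =>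
    Equiv.coe_fn_injective (congrArg Prod.fst h)
  have hr : range F = {p | ∀ k, p.1 (p.2 k) = k ∧ p.2 (p.1 k) = k} := by
    ext p
    constructor
    · rintro ⟨f, rfl⟩ k
      simp [F]
    · intro h
      exact ⟨⟨p.1, p.2, fun k => (h k).2, fun k => (h k).1⟩, rfl⟩
  have heval : Continuous fun q : (ℕ → ℕ) × ℕ => q.1 q.2 :=
    continuous_prod_of_discrete_right.2 continuous_apply
  refine IsClosedEmbedding.polishSpace (f := F) ⟨⟨hind, hinj⟩, ?_⟩
  rw [hr]
  simp only [ofPred_forall]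
  refine isClosed_iInter fun k => ?_
  refine IsClosed.inter (isClosed_eq ?_ continuous_const) (isClosed_eq ?_ continuous_const)
  · exact heval.comp (continuous_fst.prodMk ((continuous_apply k).comp continuous_snd))
  · exact heval.comp (continuous_snd.prodMk ((continuous_apply k).comp continuous_fst))

variable {G : Subgroup (Equiv.Perm ℕ)}

variable (G) in
/-- The pointwise stabilizer `V_c^G` of a finite set `c`, as a subgroup of `G`. -/
def fixer (c : Finset ℕ) : Subgroup G where
  carrier := fixing G c
  mul_mem' {g h} hg hh k hk := by
    change (g : Equiv.Perm ℕ) ((h : Equiv.Perm ℕ) k) = k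
    rw [hh k hk, hg k hk]
  one_mem' _ _ := rfl
  inv_mem' {g} hg k hk := by
    change (g : Equiv.Perm ℕ)⁻¹ k = k
    rw [Equiv.Perm.inv_eq_iff_eq, hg k hk]

lemma mem_fixer {c : Finset ℕ} {g : G} : g ∈ fixer G c ↔ ∀ k ∈ c, g • k = k := Iff.rfl

lemma fixer_anti {c d : Finset ℕ} (h : c ⊆ d) : fixer G d ≤ fixer G c :=
  fun _ hg k hk => hg k (h hk)

lemma mem_fixer_empty (g : G) : g ∈ fixer G ∅ := fun _ hk => by simp at hk

lemma smul_eq_of_mem_fixer {c : Finset ℕ} {g : G} (hg : g ∈ fixer G c) : g • c = c := by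
  ext k
  rw [Finset.mem_smul_finset]
  constructor
  · rintro ⟨j, hj, rfl⟩
    rwa [mem_fixer.1 hg j hj]
  · exact fun hk => ⟨k, hk, mem_fixer.1 hg k hk⟩

lemma conj_mem_fixer {c : Finset ℕ} {g : G} (h : G) (hg : g ∈ fixer G c) :
    h * g * h⁻¹ ∈ fixer G (h • c) := by
  rw [mem_fixer]
  intro k hk
  obtain ⟨j, hj, rfl⟩ := Finset.mem_smul_finset.1 hk
  rw [smul_smul, inv_mul_cancel_right, mul_smul, mem_fixer.1 hg j hj]

lemma continuous_smul_nat (k : ℕ) : Continuous fun g : G => g • k :=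
  (continuous_perm_apply k).comp continuous_subtype_val

lemma isOpen_fixer (c : Finset ℕ) : IsOpen (fixer G c : Set G) := by
  have : (fixer G c : Set G) = ⋂ k ∈ c, (fun g : G => g • k) ⁻¹' {k} := by
    ext g
    simp [mem_fixer]
  rw [this]
  exact isOpen_biInter_finset fun k _ => (isOpen_discrete _).preimage (continuous_smul_nat k)

lemma exists_fixer_subset {U : Set G} (hU : IsOpen U) (h1 : (1 : G) ∈ U) :
    ∃ c : Finset ℕ, (fixer G c : Set G) ⊆ U := by
  have hind : IsInducing (fun g : G => ((g : Equiv.Perm ℕ) : ℕ → ℕ)) :=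
    IsInducing.comp (g := fun f : Equiv.Perm ℕ => (f : ℕ → ℕ)) ⟨rfl⟩ IsInducing.subtypeVal
  obtain ⟨W, hW, rfl⟩ := hind.isOpen_iff.1 hU
  obtain ⟨c, u, hu, hc⟩ := isOpen_pi_iff.1 hW _ h1
  refine ⟨c, fun g hg => hc fun k hk => ?_⟩
  change (g : Equiv.Perm ℕ) k ∈ u k
  rw [show (g : Equiv.Perm ℕ) k = k from hg k hk]
  exact (hu k hk).2

/-- Right cosets of the groups `V_a` with `a ⊇ c` are a neighbourhood basis. -/
lemma exists_coset_subset {U : Set G} (hU : IsOpen U) {h : G} (hh : h ∈ U) (c : Finset ℕ) :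
    ∃ a, c ⊆ a ∧ ∀ g ∈ fixer G a, g * h ∈ U := by
  obtain ⟨a, ha⟩ := exists_fixer_subset (hU.preimage (continuous_mul_const h))
    (show (1 : G) * h ∈ U by simpa using hh)
  exact ⟨c ∪ a, Finset.subset_union_left,
    fun g hg => ha (fixer_anti Finset.subset_union_right hg)⟩

end

/-! ### The back-and-forth equivalence -/

section

section BackForth

variable (G : Subgroup (Equiv.Perm ℕ)) {X : Type*} [TopologicalSpace X] [MulAction G X]

/-- The back-and-forth equivalence of rank `β > 0` of the points `z` and `y` over the finite set
`c`. In rank `1` it says that `V_c z` and `V_c y` have the same closure; in higher ranks any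
larger finite set can be answered, on either side, at every smaller positive rank. All smaller
ranks are treated alike, so that no case distinction between successors and limits is needed. -/
def BackForth (β : Ordinal.{0}) (c : Finset ℕ) (z y : X) : Prop :=
  (∀ U : Set X, IsOpen U → ((∃ g ∈ fixer G c, g • z ∈ U) ↔ ∃ g ∈ fixer G c, g • y ∈ U)) ∧
  ∀ γ : Ordinal.{0}, 0 < γ → ∀ _ : γ < β, ∀ b, c ⊆ b →
    (∃ g ∈ fixer G c, BackForth γ b (g • z) y) ∧ ∃ g ∈ fixer G c, BackForth γ b z (g • y)
termination_by β

variable {G} {β γ : Ordinal.{0}} {a b c : Finset ℕ} {z y w : X} {g : G}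

lemma BackForth.mono (hβ : BackForth G β c z y) (hγ : γ ≤ β) : BackForth G γ c z y := by
  rw [BackForth] at hβ ⊢
  exact ⟨hβ.1, fun δ hδ hδγ => hβ.2 δ hδ (hδγ.trans_le hγ)⟩

lemma BackForth.forth (hβ : BackForth G β c z y) (h0 : 0 < γ) (hγ : γ < β) (hb : c ⊆ b) :
    ∃ g ∈ fixer G c, BackForth G γ b (g • z) y := by
  rw [BackForth] at hβ
  exact (hβ.2 γ h0 hγ b hb).1

lemma BackForth.back (hβ : BackForth G β c z y) (h0 : 0 < γ) (hγ : γ < β) (hb : c ⊆ b) :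
    ∃ g ∈ fixer G c, BackForth G γ b z (g • y) := by
  rw [BackForth] at hβ
  exact (hβ.2 γ h0 hγ b hb).2

lemma BackForth.meets_iff (hβ : BackForth G β c z y) {U : Set X} (hU : IsOpen U) :
    (∃ g ∈ fixer G c, g • z ∈ U) ↔ ∃ g ∈ fixer G c, g • y ∈ U := by
  rw [BackForth] at hβ
  exact hβ.1 U hU

variable (β c z) in
lemma BackForth.refl : BackForth G β c z z := by
  induction β using WellFoundedLT.induction generalizing c z with
  | ind β ih =>
    rw [BackForth]
    refine ⟨fun U _ => Iff.rfl, fun γ _ hγ b _ => ⟨⟨1, one_mem _, ?_⟩, ⟨1, one_mem _, ?_⟩⟩⟩ <;>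
    · rw [one_smul]
      exact ih γ hγ b z

lemma BackForth.symm (hβ : BackForth G β c z y) : BackForth G β c y z := by
  induction β using WellFoundedLT.induction generalizing c z y with
  | ind β ih =>
    rw [BackForth]
    refine ⟨fun U hU => (hβ.meets_iff hU).symm, fun γ h0 hγ b hb => ⟨?_, ?_⟩⟩
    · obtain ⟨g, hg, h⟩ := hβ.back h0 hγ hb
      exact ⟨g, hg, ih γ hγ h⟩
    · obtain ⟨g, hg, h⟩ := hβ.forth h0 hγ hb
      exact ⟨g, hg, ih γ hγ h⟩

lemma BackForth.smul [ContinuousConstSMul G X] (h : G) (hβ : BackForth G β c z y) :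
    BackForth G β (h • c) (h • z) (h • y) := by
  induction β using WellFoundedLT.induction generalizing c z y with
  | ind β ih =>
    have conj : ∀ {g : G}, g ∈ fixer G (h • c) → h⁻¹ * g * h ∈ fixer G c := fun hg => by
      simpa using conj_mem_fixer h⁻¹ hg
    rw [BackForth]
    refine ⟨fun U hU => ?_, fun γ h0 hγ b hb => ?_⟩
    · have key : ∀ u : X, (∃ g ∈ fixer G (h • c), g • h • u ∈ U) ↔
          ∃ g ∈ fixer G c, g • u ∈ (h • · : X → X) ⁻¹' U := fun u => by
        constructor
        · rintro ⟨g, hg, hu⟩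
          exact ⟨_, conj hg, by simpa [mul_smul] using hu⟩
        · rintro ⟨g, hg, hu⟩
          exact ⟨_, conj_mem_fixer h hg, by simpa [mul_smul] using hu⟩
      rw [key, key]
      exact hβ.meets_iff (hU.preimage (continuous_const_smul h))
    · have hb' : c ⊆ h⁻¹ • b := by
        rwa [Finset.subset_smul_finset_iff, inv_inv]
      constructor
      · obtain ⟨g, hg, hgy⟩ := hβ.forth h0 hγ hb'
        refine ⟨_, conj_mem_fixer h hg, ?_⟩
        simpa [mul_smul] using ih γ hγ hgy
      · obtain ⟨g, hg, hgy⟩ := hβ.back h0 hγ hb'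
        refine ⟨_, conj_mem_fixer h hg, ?_⟩
        simpa [mul_smul] using ih γ hγ hgy

lemma BackForth.smul_iff [ContinuousConstSMul G X] (h : G) :
    BackForth G β (h • c) (h • z) (h • y) ↔ BackForth G β c z y := by
  refine ⟨fun H => ?_, BackForth.smul h⟩
  simpa using H.smul h⁻¹

lemma subset_inv_smul (hg : g ∈ fixer G c) (hb : c ⊆ b) : c ⊆ g⁻¹ • b := by
  rwa [Finset.subset_smul_finset_iff, inv_inv, smul_eq_of_mem_fixer hg]

lemma BackForth.trans [ContinuousConstSMul G X] (hzy : BackForth G β c z y)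
    (hyw : BackForth G β c y w) : BackForth G β c z w := by
  induction β using WellFoundedLT.induction generalizing c z y w with
  | ind β ih =>
    rw [BackForth]
    refine ⟨fun U hU => (hzy.meets_iff hU).trans (hyw.meets_iff hU),
      fun γ h0 hγ b hb => ⟨?_, ?_⟩⟩
    · obtain ⟨g, hg, hgy⟩ := hyw.forth h0 hγ hb
      obtain ⟨k, hk, hkz⟩ := hzy.forth h0 hγ (subset_inv_smul hg hb)
      refine ⟨g * k, mul_mem hg hk, ih γ hγ ?_ hgy⟩
      simpa [mul_smul] using hkz.smul g
    · obtain ⟨g, hg, hgy⟩ := hzy.back h0 hγ hb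
      obtain ⟨k, hk, hkz⟩ := hyw.back h0 hγ (subset_inv_smul hg hb)
      refine ⟨g * k, mul_mem hg hk, ih γ hγ hgy ?_⟩
      simpa [mul_smul] using hkz.smul g

/-- The action of `V_c` does not change the class over `c`. -/
lemma BackForth.smul_right_of_mem [ContinuousConstSMul G X] (hg : g ∈ fixer G c)
    (hβ : BackForth G β c z y) : BackForth G β c z (g • y) := by
  have hg' := inv_mem hg
  rw [BackForth]
  refine ⟨fun U hU => (hβ.meets_iff hU).trans ?_, fun γ h0 hγ b hb => ⟨?_, ?_⟩⟩
  · constructor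
    · rintro ⟨k, hk, hU⟩
      exact ⟨k * g⁻¹, mul_mem hk hg', by simpa [mul_smul] using hU⟩
    · rintro ⟨k, hk, hU⟩
      exact ⟨k * g, mul_mem hk hg, by simpa [mul_smul] using hU⟩
  · obtain ⟨k, hk, hky⟩ := hβ.forth h0 hγ (subset_inv_smul hg hb)
    exact ⟨g * k, mul_mem hg hk, by simpa [mul_smul] using hky.smul g⟩
  · obtain ⟨k, hk, hky⟩ := hβ.back h0 hγ hb
    exact ⟨k * g⁻¹, mul_mem hk hg', by simpa [mul_smul] using hky⟩

lemma BackForth.smul_left_of_mem [ContinuousConstSMul G X] (hg : g ∈ fixer G c)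
    (hβ : BackForth G β c z y) : BackForth G β c (g • z) y :=
  (hβ.symm.smul_right_of_mem hg).symm

/-- The class over a larger finite set determines the class over a smaller one. In rank `1` this
uses continuity of the action: an open set met by `V_c z` is translated to one containing `z`. -/
lemma BackForth.anti [ContinuousConstSMul G X] (hβ : BackForth G β a z y) (hc : c ⊆ a) :
    BackForth G β c z y := by
  induction β using WellFoundedLT.induction generalizing a c z y with
  | ind β ih =>
    have base : ∀ {u v : X}, BackForth G β a u v → ∀ U : Set X, IsOpen U →
        (∃ g ∈ fixer G c, g • u ∈ U) → ∃ g ∈ fixer G c, g • v ∈ U := by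
      rintro u v huv U hU ⟨g, hg, hgU⟩
      obtain ⟨k, hk, hkU⟩ := (huv.meets_iff (hU.preimage (continuous_const_smul g))).1
        ⟨1, one_mem _, by simpa using hgU⟩
      exact ⟨g * k, mul_mem hg (fixer_anti hc hk), by simpa [mul_smul] using hkU⟩
    rw [BackForth]
    refine ⟨fun U hU => ⟨base hβ U hU, base hβ.symm U hU⟩, fun γ h0 hγ b hb => ⟨?_, ?_⟩⟩
    · obtain ⟨g, hg, h⟩ := hβ.forth h0 hγ (Finset.subset_union_left : a ⊆ a ∪ b)
      exact ⟨g, fixer_anti hc hg, ih γ hγ h Finset.subset_union_right⟩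
    · obtain ⟨g, hg, h⟩ := hβ.back h0 hγ (Finset.subset_union_left : a ⊆ a ∪ b)
      exact ⟨g, fixer_anti hc hg, ih γ hγ h Finset.subset_union_right⟩

/-- Equivalence of positive rank over `a` is controlled by any higher rank over `∅`: this moves
a point of the orbit into the class of `y` over `a`. -/
lemma BackForth.exists_smul (hβ : BackForth G β ∅ z y) (h0 : 0 < γ) (hγ : γ < β)
    (a : Finset ℕ) : ∃ g : G, BackForth G γ a (g • z) y :=
  let ⟨g, _, h⟩ := hβ.forth h0 hγ (Finset.empty_subset a)
  ⟨g, h⟩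

lemma backForth_succ_iff [ContinuousConstSMul G X] (hβ : 0 < β) :
    BackForth G (β + 1) c z y ↔ ∀ b, c ⊆ b →
      (∃ g ∈ fixer G c, BackForth G β b (g • z) y) ∧
        ∃ g ∈ fixer G c, BackForth G β b z (g • y) := by
  constructor
  · exact fun h b hb => ⟨h.forth hβ (lt_add_one β) hb, h.back hβ (lt_add_one β) hb⟩
  · intro h
    rw [BackForth]
    constructor
    · obtain ⟨⟨g, hg, hgz⟩, -⟩ := h c subset_rfl
      have := hgz.smul_left_of_mem (inv_mem hg)
      rw [inv_smul_smul] at this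
      exact fun U hU => this.meets_iff hU
    · intro γ h0 hγ b hb
      have hγβ : γ ≤ β := Order.lt_add_one_iff.1 hγ
      obtain ⟨⟨g, hg, hgz⟩, k, hk, hky⟩ := h b hb
      exact ⟨⟨g, hg, hgz.mono hγβ⟩, k, hk, hky.mono hγβ⟩

lemma backForth_limit_iff (hβ : Order.IsSuccLimit β) :
    BackForth G β c z y ↔ ∀ γ, 0 < γ ∧ γ < β → BackForth G γ c z y := by
  refine ⟨fun h γ hγ => h.mono hγ.2.le, fun h => ?_⟩
  rw [BackForth]
  constructor
  · have h1 : (1 : Ordinal.{0}) < β := by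
      have := hβ.add_one_lt hβ.bot_lt
      simpa using this
    exact fun U hU => (h 1 ⟨zero_lt_one, h1⟩).meets_iff hU
  · intro γ h0 hγ b hb
    have := h (γ + 1) ⟨h0.trans (lt_add_one γ), hβ.add_one_lt hγ⟩
    exact ⟨this.forth h0 (lt_add_one γ) hb, this.back h0 (lt_add_one γ) hb⟩

end BackForth

end

/-! ### The sets `B_α(x, σ)` are back-and-forth classes -/

section

variable {G : Subgroup (Equiv.Perm ℕ)} {X : Type*} [MulAction G X]

lemma prng_restrict (f : G) (d : Finset ℕ) : prng (restrict f d) = (f • d : Finset ℕ) := by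
  ext m
  simp only [prng, mem_ofPred_eq, mem_restrict, Finset.mem_coe, Finset.mem_smul_finset]
  rfl

lemma pdom_restrict (f : Equiv.Perm ℕ) (d : Finset ℕ) : pdom (restrict f d) = d := by
  ext k
  change (∃ m, m ∈ restrict f d k) ↔ k ∈ d
  simp only [mem_restrict, exists_and_left, exists_eq', and_true]

lemma mul_inv_mem_fixer_iff {f g : G} {d : Finset ℕ} :
    g * f⁻¹ ∈ fixer G (f • d) ↔ ∀ k ∈ d, g • k = f • k := by
  rw [mem_fixer]
  constructor
  · intro h k hk
    simpa [mul_smul] using h _ (Finset.smul_mem_smul_finset hk)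
  · intro h k hk
    obtain ⟨j, hj, rfl⟩ := Finset.mem_smul_finset.1 hk
    rw [mul_smul, inv_smul_smul, h j hj]

lemma restrict_le_restrict {f f' : G} {d d' : Finset ℕ} :
    restrict f d ≤ restrict f' d' ↔ d ⊆ d' ∧ f' * f⁻¹ ∈ fixer G (f • d) := by
  rw [mul_inv_mem_fixer_iff, PEquiv.le_def]
  constructor
  · intro h
    have h' : ∀ k ∈ d, k ∈ d' ∧ (f' : Equiv.Perm ℕ) k = (f : Equiv.Perm ℕ) k := fun k hk =>
      mem_restrict.1 (h k _ (mem_restrict.2 ⟨hk, rfl⟩))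
    exact ⟨fun k hk => (h' k hk).1, fun k hk => (h' k hk).2⟩
  · rintro ⟨hd, h⟩ k m hm
    obtain ⟨hk, rfl⟩ := mem_restrict.1 hm
    exact mem_restrict.2 ⟨hd hk, h k hk⟩

lemma mem_extending_restrict {f g : G} {d : Finset ℕ} :
    g ∈ extending G (restrict f d) ↔ g * f⁻¹ ∈ fixer G (f • d) := by
  rw [mul_inv_mem_fixer_iff, mem_extending]
  constructor
  · exact fun h k hk => h k _ (mem_restrict.2 ⟨hk, rfl⟩)
  · intro h k m hm
    obtain ⟨hk, rfl⟩ := mem_restrict.1 hm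
    exact h k hk

lemma backForth_one_iff [TopologicalSpace X] {A : ℕ → Set X}
    (hA : IsTopologicalBasis (range A)) {z y : X} {c : Finset ℕ} :
    BackForth G 1 c z y ↔
      ∀ l, (∃ g ∈ fixer G c, g • z ∈ A l) ↔ ∃ g ∈ fixer G c, g • y ∈ A l := by
  rw [BackForth]
  constructor
  · exact fun h l => h.1 _ (hA.isOpen (mem_range_self l))
  · intro h
    refine ⟨fun U hU => ?_, fun γ h0 hγ => absurd (Order.lt_one_iff.1 hγ) h0.ne'⟩
    have basic : ∀ u : X, (∃ g ∈ fixer G c, g • u ∈ U) ↔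
        ∃ l, A l ⊆ U ∧ ∃ g ∈ fixer G c, g • u ∈ A l := by
      intro u
      constructor
      · rintro ⟨g, hg, hu⟩
        obtain ⟨_, ⟨l, rfl⟩, hl, hlU⟩ := hA.exists_subset_of_mem_open hu hU
        exact ⟨l, hlU, g, hg, hl⟩
      · rintro ⟨l, hlU, g, hg, hu⟩
        exact ⟨g, hg, hlU hu⟩
    rw [basic, basic]
    exact exists_congr fun l => and_congr_right fun _ => h l

lemma mem_alphaSetOne_iff [TopologicalSpace X] {A : ℕ → Set X}
    (hA : IsTopologicalBasis (range A)) {x y : X} (f : G) (d : Finset ℕ) :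
    y ∈ alphaSetOne G A x (restrict f d) ↔ BackForth G 1 (f • d) (f • x) y := by
  have h1 : ∀ l, (((fun g : G => g • x) '' extending G (restrict f d)) ∩ A l).Nonempty ↔
      ∃ g ∈ fixer G (f • d), g • f • x ∈ A l := by
    intro l
    constructor
    · rintro ⟨_, ⟨g, hg, rfl⟩, hl⟩
      exact ⟨_, mem_extending_restrict.1 hg, by simpa [mul_smul] using hl⟩
    · rintro ⟨g, hg, hl⟩
      exact ⟨_, ⟨g * f, mem_extending_restrict.2 (by simpa using hg), rfl⟩,
        by simpa [mul_smul] using hl⟩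
  have h2 : ∀ l, y ∈ fixing G (prng (restrict f d)) • A l ↔
      ∃ g ∈ fixer G (f • d), g • y ∈ A l := by
    intro l
    rw [prng_restrict]
    constructor
    · rintro ⟨g, hg, z, hz, rfl⟩
      exact ⟨g⁻¹, inv_mem (show g ∈ fixer G (f • d) from hg), by simpa using hz⟩
    · rintro ⟨g, hg, hl⟩
      exact ⟨g⁻¹, inv_mem hg, _, hl, by simp⟩
  rw [backForth_one_iff hA]
  constructor
  · rintro ⟨ha, hb⟩ l
    refine ⟨fun h => (h2 l).1 (ha l ((h1 l).2 h)), fun h => ?_⟩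
    by_contra hn
    exact hb l (not_nonempty_iff_eq_empty.1 fun h' => hn ((h1 l).1 h')) ((h2 l).2 h)
  · intro h
    refine ⟨fun l hl => (h2 l).2 ((h l).1 ((h1 l).1 hl)), fun l hl hy => ?_⟩
    exact not_nonempty_iff_eq_empty.2 hl ((h1 l).2 ((h l).2 ((h2 l).1 hy)))

/-- `B_β(x, f|_d)` is the back-and-forth class of `f x` of rank `β` over `f(d)`. -/
lemma mem_alphaSet_iff [TopologicalSpace X] [ContinuousConstSMul G X] {A : ℕ → Set X}
    (hA : IsTopologicalBasis (range A)) {x y : X} {β : Ordinal.{0}}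
    (hβ : 0 < β) (f : G) (d : Finset ℕ) :
    y ∈ alphaSet G A x β (restrict f d) ↔ BackForth G β (f • d) (f • x) y := by
  induction β using Ordinal.limitRecOn generalizing f d with
  | zero => exact absurd hβ (lt_irrefl _)
  | add_one β ih =>
    rcases eq_or_ne β 0 with rfl | h0
    · rw [zero_add, alphaSet_one, mem_alphaSetOne_iff hA]
    have hpos : 0 < β := pos_iff_ne_zero.2 h0
    rw [alphaSet_add_one G A x hpos, backForth_succ_iff hpos]
    constructor
    · rintro ⟨hback, hforth⟩ b hb
      constructor
      · obtain ⟨_, ⟨f', hf', d', rfl⟩, hle, hr, hy⟩ := hforth b (by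
          rw [prng_restrict]
          exact_mod_cast hb)
        lift f' to G using hf'
        rw [prng_restrict, Finset.coe_inj] at hr
        refine ⟨_, (restrict_le_restrict.1 hle).2, ?_⟩
        rw [ih hpos, hr] at hy
        simpa [mul_smul] using hy
      · obtain ⟨_, ⟨f', hf', d', rfl⟩, hle, hr, hy⟩ := hback (f⁻¹ • b) (by
          rw [pdom_restrict, Finset.coe_subset]
          rwa [Finset.subset_smul_finset_iff, inv_inv])
        lift f' to G using hf'
        rw [pdom_restrict, Finset.coe_inj] at hr
        subst hr
        refine ⟨_, inv_mem (restrict_le_restrict.1 hle).2, ?_⟩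
        rw [ih hpos] at hy
        simpa [mul_smul] using hy.smul (f' * f⁻¹)⁻¹
    · intro h
      constructor
      · intro b hb
        rw [pdom_restrict, Finset.coe_subset] at hb
        obtain ⟨-, g, hg, hgy⟩ := h (f • b) (Finset.smul_finset_subset_smul_finset_iff.2 hb)
        refine ⟨restrict (g⁻¹ * f : G) b, ⟨_, (g⁻¹ * f).2, b, rfl⟩, restrict_le_restrict.2
          ⟨hb, by simpa using hg⟩, pdom_restrict _ _, ?_⟩
        rw [ih hpos]
        simpa [mul_smul] using hgy.smul g⁻¹
      · intro a ha
        rw [prng_restrict, Finset.coe_subset] at ha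
        obtain ⟨⟨g, hg, hgz⟩, -⟩ := h a ha
        refine ⟨restrict (g * f : G) ((g * f)⁻¹ • a), ⟨_, (g * f).2, _, rfl⟩,
          restrict_le_restrict.2 ⟨?_, by simpa using hg⟩, ?_, ?_⟩
        · rw [Finset.subset_smul_finset_iff, inv_inv, mul_smul, smul_eq_of_mem_fixer hg]
          exact ha
        · rw [prng_restrict, smul_inv_smul]
        · rw [ih hpos, smul_inv_smul, mul_smul]
          exact hgz
  | limit lam hlam ih =>
    rw [alphaSet_limit G A x hlam, backForth_limit_iff hlam]
    simp only [mem_iInter]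
    exact forall₂_congr fun γ hγ => ih γ hγ.2 hγ.1 f d

lemma restrict_one_empty : restrict (1 : G) ∅ = ⊥ := by
  refine PEquiv.ext fun k => Option.ext fun m => ?_
  change m ∈ restrict (1 : G) ∅ k ↔ m ∈ (⊥ : ℕ ≃. ℕ) k
  rw [mem_restrict]
  simp

lemma mem_alphaSet_bot_iff [TopologicalSpace X] [ContinuousConstSMul G X] {A : ℕ → Set X}
    (hA : IsTopologicalBasis (range A)) {x y : X} {β : Ordinal.{0}}
    (hβ : 0 < β) : y ∈ alphaSet G A x β ⊥ ↔ BackForth G β ∅ x y := by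
  rw [← restrict_one_empty (G := G), mem_alphaSet_iff hA hβ, one_smul, one_smul]

end

/-! ### Vaught transforms -/

section

lemma IsSigma0.measurableSet {X : Type*} [TopologicalSpace X] [MeasurableSpace X] [BorelSpace X]
    {β : Ordinal.{0}} {C : Set X} (hC : IsSigma0 β C) : MeasurableSet C := by
  induction hC with
  | of_isOpen U hU => exact hU.measurableSet
  | iUnion α hα β hβ S hS ih => exact MeasurableSet.iUnion fun n => (ih n).of_compl

variable (G : Subgroup (Equiv.Perm ℕ)) {X : Type*} [MulAction G X]

/-- `MeagrelyMeets G c C y`: the set of `g ∈ V_c` with `g y ∈ C` is meagre in `G`. The negation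
says that `y` lies in the Vaught transform `C^{Δ V_c}`. -/
def MeagrelyMeets (c : Finset ℕ) (C : Set X) (y : X) : Prop :=
  IsMeagre {g : G | g ∈ fixer G c ∧ g • y ∈ C}

variable {G} {c : Finset ℕ} {C : Set X} {y : X}

lemma meagrelyMeets_iUnion {S : ℕ → Set X} :
    MeagrelyMeets G c (⋃ n, S n) y ↔ ∀ n, MeagrelyMeets G c (S n) y := by
  constructor
  · intro h n
    refine h.mono ?_
    rintro g ⟨hg, hgy⟩
    exact ⟨hg, mem_iUnion.2 ⟨n, hgy⟩⟩
  · intro h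
    refine (isMeagre_iUnion h).mono ?_
    rintro g ⟨hg, hgy⟩
    obtain ⟨n, hn⟩ := mem_iUnion.1 hgy
    exact mem_iUnion.2 ⟨n, hg, hn⟩

/-- An open set is met non-meagrely as soon as it is met. -/
lemma not_meagrelyMeets_iff_of_isOpen [BaireSpace G] [TopologicalSpace X] [ContinuousSMul G X]
    (hC : IsOpen C) : ¬ MeagrelyMeets G c C y ↔ ∃ g ∈ fixer G c, g • y ∈ C := by
  constructor
  · intro h
    obtain ⟨g, hg⟩ := nonempty_of_not_isMeagre h
    exact ⟨g, hg⟩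
  · rintro ⟨g, hg⟩
    exact not_isMeagre_of_isOpen ((isOpen_fixer c).inter
      (hC.preimage (continuous_id.smul continuous_const)))
      (show Set.Nonempty _ from ⟨g, hg⟩)

lemma isMeagre_preimage_mul_right {s : Set G} (hs : IsMeagre s) (h : G) :
    IsMeagre ((· * h) ⁻¹' s) :=
  hs.preimage_of_isOpenMap (continuous_mul_const h) (isOpenMap_mul_right h)

lemma MeagrelyMeets.smul_of_mem {g : G} (h : MeagrelyMeets G c C y) (hg : g ∈ fixer G c) :
    MeagrelyMeets G c C (g • y) := by
  refine (isMeagre_preimage_mul_right h g).mono ?_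
  rintro k ⟨hk, hky⟩
  exact ⟨mul_mem hk hg, by simpa [mul_smul] using hky⟩

/-- A set of the form `C^{Δ V_c}` decomposes into translates of sets `(Cᶜ)^{* V_a}`. The forward
direction is the Baire property of `{g | g y ∈ C}`; the converse is the Baire category theorem. -/
lemma not_meagrelyMeets_iff [BaireSpace G] [TopologicalSpace X] [ContinuousSMul G X]
    [MeasurableSpace X] [BorelSpace X] (hC : MeasurableSet C) :
    ¬ MeagrelyMeets G c C y ↔
      ∃ a, c ⊆ a ∧ ∃ h ∈ fixer G c, MeagrelyMeets G a Cᶜ (h • y) := by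
  constructor
  · intro hne
    let : MeasurableSpace G := borel G
    have : BorelSpace G := ⟨rfl⟩
    set s : Set G := {g | g ∈ fixer G c ∧ g • y ∈ C} with hs
    have hcont : Continuous fun g : G => g • y := continuous_id.smul continuous_const
    have hsm : MeasurableSet s := (isOpen_fixer c).measurableSet.inter (hcont.measurable hC)
    obtain ⟨u, hu, hsu⟩ := hsm.residualEq_isOpen
    have hmeag : IsMeagre (u \ s) := by
      filter_upwards [hsu.mem_iff] with g hg hgu
      exact hgu.2 (hg.2 hgu.1)
    have hmeag' : IsMeagre (s \ u) := by
      filter_upwards [hsu.mem_iff] with g hg hgu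
      exact hgu.2 (hg.1 hgu.1)
    have hex : ∃ h ∈ s, h ∈ u := by
      by_contra! hcon
      have hsu' : s ⊆ s \ u := fun g hg => ⟨hg, hcon g hg⟩
      exact hne (hmeag'.mono hsu')
    obtain ⟨h, ⟨hhc, -⟩, hhu⟩ := hex
    obtain ⟨a, hca, ha⟩ := exists_coset_subset hu hhu c
    refine ⟨a, hca, h, hhc, (isMeagre_preimage_mul_right hmeag h).mono ?_⟩
    rintro g ⟨hg, hgC⟩
    exact ⟨ha g hg, fun hgs => hgC (by simpa [mul_smul] using hgs.2)⟩
  · rintro ⟨a, hca, h, hh, hmeag⟩ hcon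
    have h1 : IsMeagre {g : G | g ∈ fixer G a ∧ g • h • y ∈ C} := by
      refine (isMeagre_preimage_mul_right hcon h).mono ?_
      rintro g ⟨hg, hgC⟩
      exact ⟨mul_mem (fixer_anti hca hg) hh, by simpa [mul_smul] using hgC⟩
    refine not_isMeagre_of_isOpen (isOpen_fixer (G := G) a)
      (show Set.Nonempty _ from ⟨1, one_mem (fixer G a)⟩)
      ((h1.union hmeag).mono fun g hg => ?_)
    by_cases hgC : g • h • y ∈ C
    · exact Or.inl ⟨hg, hgC⟩
    · exact Or.inr ⟨hg, hgC⟩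

/-- Points that are equivalent of rank `β` over `c` lie in the same Vaught transforms, with
respect to `V_c`, of `𝚺⁰_β` sets. -/
lemma BackForth.meagrelyMeets_iff [BaireSpace G] [TopologicalSpace X] [ContinuousSMul G X]
    {β : Ordinal.{0}} (hC : IsSigma0 β C) {z : X} (hzy : BackForth G β c z y) :
    MeagrelyMeets G c C z ↔ MeagrelyMeets G c C y := by
  let : MeasurableSpace X := borel X
  have : BorelSpace X := ⟨rfl⟩
  induction hC generalizing c z y with
  | of_isOpen U hU =>
    rw [← not_iff_not, not_meagrelyMeets_iff_of_isOpen hU, not_meagrelyMeets_iff_of_isOpen hU]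
    exact hzy.meets_iff hU
  | iUnion α hα β hβ S hS ih =>
    have key : ∀ {u v : X}, BackForth G α c u v → ∀ n, ¬ MeagrelyMeets G c (S n) u →
        ¬ MeagrelyMeets G c (S n) v := by
      intro u v huv n hn
      have hSn : MeasurableSet (S n) := (hS n).measurableSet.of_compl
      obtain ⟨a, hca, h, hh, hmeag⟩ := (not_meagrelyMeets_iff hSn).1 hn
      obtain ⟨g, hg, hgv⟩ := (huv.smul_left_of_mem hh).back
        (zero_lt_one.trans_le (hβ n).1) (hβ n).2 hca
      exact (not_meagrelyMeets_iff hSn).2 ⟨a, hca, g, hg, (ih n hgv).1 hmeag⟩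
    rw [meagrelyMeets_iUnion, meagrelyMeets_iUnion]
    exact forall_congr' fun n => ⟨fun h => by_contra fun h' => key hzy.symm n h' h,
      fun h => by_contra fun h' => key hzy n h' h⟩

lemma smul_mem_orbit_iff {x : X} (g : G) :
    g • y ∈ MulAction.orbit G x ↔ y ∈ MulAction.orbit G x := by
  rw [← MulAction.orbit_eq_iff, MulAction.orbit_smul, MulAction.orbit_eq_iff]

/-- An invariant set is recovered from its complement by category: it contains exactly the points
whose orbit meets the complement meagrely. -/
lemma meagrelyMeets_compl_orbit_iff [BaireSpace G] {x : X} :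
    MeagrelyMeets G ∅ (MulAction.orbit G x)ᶜ y ↔ y ∈ MulAction.orbit G x := by
  constructor
  · intro h
    by_contra hy
    refine not_isMeagre_of_isOpen (isOpen_univ (X := G)) univ_nonempty (h.mono fun g _ => ?_)
    exact ⟨mem_fixer_empty g, fun hg => hy ((smul_mem_orbit_iff g).1 hg)⟩
  · rintro hy
    refine IsMeagre.empty.mono ?_
    rintro g ⟨-, hg⟩
    exact hg ((smul_mem_orbit_iff g).2 hy)

/-- A `𝚷⁰_β` orbit is a single back-and-forth class of rank `β`. -/
lemma BackForth.mem_orbit [BaireSpace G] [TopologicalSpace X] [ContinuousSMul G X] {x : X}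
    {β : Ordinal.{0}} (hx : IsPi0 β (MulAction.orbit G x)) (hxy : BackForth G β ∅ x y) :
    y ∈ MulAction.orbit G x :=
  meagrelyMeets_compl_orbit_iff.1
    ((hxy.meagrelyMeets_iff hx).1 (meagrelyMeets_compl_orbit_iff.2 (MulAction.mem_orbit_self x)))

end

/-! ### Polish spaces: `G_δ` subsets and open orbits -/

section

/-- A space that embeds as a `G_δ` set into a Polish space is Polish: if the image is `⋂ n, U n`,
the space is the closed diagonal of the Polish space `Π n, U n`. -/
lemma polishSpace_of_isEmbedding_of_isGδ_range {Y Z : Type*} [TopologicalSpace Y]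
    [TopologicalSpace Z] [PolishSpace Z] {f : Y → Z} (hf : IsEmbedding f)
    (hr : IsGδ (range f)) : PolishSpace Y := by
  obtain ⟨U, hU, hUr⟩ := isGδ_iff_eq_iInter_nat.1 hr
  have hpol : ∀ n, PolishSpace (U n) := fun n => (hU n).polishSpace
  have hfU : ∀ y n, f y ∈ U n := fun y n => mem_iInter.1 (hUr ▸ mem_range_self y) n
  let F : Y → ∀ n, U n := fun y n => ⟨f y, hfU y n⟩
  have hFc : Continuous F :=
    continuous_pi fun n => hf.continuous.subtype_mk _
  have hproj : Continuous fun p : ∀ n, U n => (p 0 : Z) :=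
    continuous_subtype_val.comp (continuous_apply 0)
  have hemb : IsEmbedding F := IsEmbedding.of_comp hFc hproj hf
  have hclosed : range F = {p | ∀ n, (p n : Z) = p 0} := by
    ext p
    constructor
    · rintro ⟨y, rfl⟩ n
      rfl
    · intro hp
      have : (p 0 : Z) ∈ range f := by
        rw [hUr]
        exact mem_iInter.2 fun n => hp n ▸ (p n).2
      obtain ⟨y, hy⟩ := this
      exact ⟨y, funext fun n => Subtype.ext (hy.trans (hp n).symm)⟩
  refine IsClosedEmbedding.polishSpace (f := F) ⟨hemb, ?_⟩
  rw [hclosed]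
  simp only [ofPred_forall]
  exact isClosed_iInter fun n =>
    isClosed_eq (continuous_subtype_val.comp (continuous_apply n)) hproj

lemma isMeagre_smul {G Y : Type*} [Group G] [TopologicalSpace Y] [MulAction G Y]
    [ContinuousConstSMul G Y] {s : Set Y} (hs : IsMeagre s) (g : G) :
    IsMeagre ((g • · : Y → Y) ⁻¹' s) :=
  hs.preimage_of_isOpenMap (continuous_const_smul g) (isOpenMap_smul g)

section OpenOrbit

variable {G Y : Type*} [Group G] [TopologicalSpace G] [IsTopologicalGroup G] [PolishSpace G]
  [TopologicalSpace Y] [PolishSpace Y] [MulAction G Y]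

/-- The orbits of an open subgroup `V` in a transitive space are countably many analytic sets that
partition the space, hence they are Borel. -/
lemma measurableSet_orbit_of_isOpen [MulAction.IsPretransitive G Y] [MeasurableSpace Y]
    [BorelSpace Y] (hc : ∀ y : Y, Continuous fun g : G => g • y) {V : Subgroup G}
    (hV : IsOpen (V : Set G)) (y : Y) : MeasurableSet (MulAction.orbit V y) := by
  have hana : ∀ z : Y, MeasureTheory.AnalyticSet (MulAction.orbit V z) := fun z => by
    have : MulAction.orbit V z = (fun g : G => g • z) '' (V : Set G) := by
      ext w
      constructor
      · rintro ⟨v, rfl⟩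
        exact ⟨v, v.2, rfl⟩
      · rintro ⟨v, hv, rfl⟩
        exact ⟨⟨v, hv⟩, rfl⟩
    rw [this]
    exact hV.analyticSet_image (hc z)
  refine (hana y).measurableSet_of_compl ?_
  have hcompl : (MulAction.orbit V y)ᶜ =
      ⋃ n : {n : ℕ // denseSeq G n • y ∉ MulAction.orbit V y},
        MulAction.orbit V (denseSeq G n • y) := by
    ext z
    rw [mem_iUnion]
    constructor
    · intro hz
      obtain ⟨g, rfl⟩ := MulAction.exists_smul_eq G y z
      obtain ⟨_, hv, n, rfl⟩ := (denseRange_denseSeq G).inter_open_nonempty _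
        (hV.preimage (continuous_mul_const g⁻¹)) ⟨g, by simp⟩
      have hmem : g • y ∈ MulAction.orbit V (denseSeq G n • y) :=
        ⟨⟨_, inv_mem hv⟩, by simp [Subgroup.smul_def, smul_smul]⟩
      refine ⟨⟨n, fun hn => hz ?_⟩, hmem⟩
      rw [← MulAction.orbit_eq_iff] at hn hmem ⊢
      rw [hmem, hn]
    · rintro ⟨⟨n, hn⟩, hz⟩ hzy
      rw [← MulAction.orbit_eq_iff] at hz hzy
      exact hn (MulAction.orbit_eq_iff.1 (hz ▸ hzy))
  rw [hcompl]
  exact MeasureTheory.AnalyticSet.iUnion fun n => hana _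

/-- Countably many translates of an orbit of an open subgroup cover a transitive space, so none
of these orbits is meagre. -/
lemma not_isMeagre_orbit_of_isOpen [MulAction.IsPretransitive G Y] [ContinuousConstSMul G Y]
    {V : Subgroup G} (hV : IsOpen (V : Set G)) (y : Y) : ¬ IsMeagre (MulAction.orbit V y) := by
  intro h
  refine not_isMeagre_of_isOpen (isOpen_univ (X := Y)) ⟨y, mem_univ y⟩
    ((isMeagre_iUnion fun n => isMeagre_smul h (denseSeq G n)⁻¹).mono fun z _ => ?_)
  obtain ⟨g, rfl⟩ := MulAction.exists_smul_eq G y z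
  obtain ⟨_, hv, n, rfl⟩ := (denseRange_denseSeq G).inter_open_nonempty _
    (hV.preimage (continuous_const_mul g⁻¹)) ⟨g, by simp⟩
  refine mem_iUnion.2 ⟨n, ⟨_, inv_mem hv⟩, ?_⟩
  simp [Subgroup.smul_def, mul_smul]

/-- The form of Effros' theorem used here: if a Polish group acts transitively and
continuously on a Polish space, the orbits of its open subgroups are open. -/
theorem isOpen_orbit_of_isOpen [MulAction.IsPretransitive G Y] [ContinuousConstSMul G Y]
    (hc : ∀ y : Y, Continuous fun g : G => g • y) {V : Subgroup G} (hV : IsOpen (V : Set G))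
    (y : Y) : IsOpen (MulAction.orbit V y) := by
  let : MeasurableSpace Y := borel Y
  have : BorelSpace Y := ⟨rfl⟩
  have hcomeagre : ∀ z : Y, ∃ u : Set Y, IsOpen u ∧ IsMeagre (u \ MulAction.orbit V z) ∧
      ∃ p ∈ u, p ∈ MulAction.orbit V z := by
    intro z
    obtain ⟨u, hu, hsu⟩ := (measurableSet_orbit_of_isOpen hc hV z).residualEq_isOpen
    refine ⟨u, hu, ?_, ?_⟩
    · filter_upwards [hsu.mem_iff] with g hg hgu
      exact hgu.2 (hg.2 hgu.1)
    · by_contra! hcon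
      refine not_isMeagre_orbit_of_isOpen hV z ?_
      filter_upwards [hsu.mem_iff] with g hg hgu
      exact hcon g (hg.1 hgu) hgu
  obtain ⟨u, hu, hmeag, p, hpu, hp⟩ := hcomeagre y
  -- Two orbits that are both comeagre in some nonempty open set coincide.
  have hsub : u ⊆ MulAction.orbit V y := by
    intro z hz
    obtain ⟨w, hw, hwmeag, q, hqw, v, rfl⟩ := hcomeagre z
    by_contra hzy
    have hne : ((v • · : Y → Y) ⁻¹' w ∩ u).Nonempty := ⟨z, hqw, hz⟩
    refine not_isMeagre_of_isOpen ((hw.preimage (continuous_const_smul (v : G))).inter hu) hne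
      (((isMeagre_smul hwmeag (v : G)).union hmeag).mono ?_)
    rintro t ⟨htw, htu⟩
    by_cases ht : t ∈ MulAction.orbit V y
    · refine Or.inl ⟨htw, fun htz => hzy ?_⟩
      have htz' : v • t ∈ MulAction.orbit V z := htz
      rw [← MulAction.orbit_eq_iff, MulAction.orbit_smul] at htz'
      rw [← MulAction.orbit_eq_iff] at ht ⊢
      rw [← htz', ht]
    · exact Or.inr ⟨htu, ht⟩
  rw [isOpen_iff_mem_nhds]
  intro s hs
  obtain ⟨v, hv⟩ : s ∈ MulAction.orbit V p := by
    rw [← MulAction.orbit_eq_iff] at hs hp ⊢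
    rw [hs, hp]
  have hs' : s ∈ (v⁻¹ • · : Y → Y) ⁻¹' u := by
    simpa [← hv] using hpu
  refine mem_of_superset ((hu.preimage (continuous_const_smul ((v⁻¹ : V) : G))).mem_nhds hs') ?_
  intro t ht
  have ht' : v⁻¹ • t ∈ MulAction.orbit V y := hsub ht
  rw [← MulAction.orbit_eq_iff, MulAction.orbit_smul] at ht'
  exact MulAction.orbit_eq_iff.1 ht'

end OpenOrbit

end

/-! ### The topology `t^x_α` -/

section

variable {G : Subgroup (Equiv.Perm ℕ)} {X : Type*} [MulAction G X]

variable (G) in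
/-- The set `B_α(x, ∅)` as a type of its own, carrying the topology `t^x_α` rather than the
subspace topology of `X`. -/
def AlphaSpace (A : ℕ → Set X) (x : X) (α : Ordinal.{0}) : Type _ := alphaSet G A x α ⊥

namespace AlphaSpace

variable {A : ℕ → Set X} {x : X} {α : Ordinal.{0}}

instance : TopologicalSpace (AlphaSpace G A x α) := alphaTopology G A x α

/-- The inclusion of `B_α(x, ∅)` into `X`. -/
def val (y : AlphaSpace G A x α) : X := Subtype.val y

lemma val_injective : Function.Injective (val : AlphaSpace G A x α → X) :=
  Subtype.val_injective

lemma isOpen_preimage {S : Set X} (hS : S ∈ earlierFamily G A x α) :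
    IsOpen {y : AlphaSpace G A x α | y.val ∈ S} :=
  ⟨S, isOpen_generateFrom_of_mem hS, rfl⟩

lemma basis_mem_earlierFamily (hα : 0 < α) (l : ℕ) : A l ∈ earlierFamily G A x α :=
  mem_iUnion₂.2 ⟨0, hα, by simp [levelFamily]⟩

variable [TopologicalSpace X]

lemma continuous_val (hA : IsTopologicalBasis (range A)) (hα : 0 < α) :
    Continuous (val : AlphaSpace G A x α → X) :=
  hA.continuous_iff.2 fun _ ⟨l, hl⟩ =>
    hl ▸ isOpen_preimage (basis_mem_earlierFamily hα l)

variable [ContinuousConstSMul G X]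

lemma backForth (hA : IsTopologicalBasis (range A)) (hα : 0 < α) (y : AlphaSpace G A x α) :
    BackForth G α ∅ x y.val :=
  (mem_alphaSet_bot_iff hA hα).1 y.2

lemma earlierFamily_subset (hA : IsTopologicalBasis (range A)) {S : Set X}
    (hS : S ∈ earlierFamily G A x α) : IsOpen S ∨ ∃ γ : Ordinal.{0}, 0 < γ ∧ γ < α ∧
      ∃ (a : Finset ℕ) (z : X), S = {y | BackForth G γ a z y} := by
  obtain ⟨γ, hγ, hS⟩ := mem_iUnion₂.1 hS
  rcases eq_or_ne γ 0 with rfl | h0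
  · rw [levelFamily, if_pos rfl] at hS
    exact Or.inl (hA.isOpen hS)
  · rw [levelFamily, if_neg h0] at hS
    obtain ⟨_, ⟨f, hf, d, rfl⟩, rfl⟩ := hS
    have h0 : 0 < γ := pos_iff_ne_zero.2 h0
    lift f to G using hf
    exact Or.inr ⟨γ, h0, hγ, f • d, f • x, Set.ext fun y => mem_alphaSet_iff hA h0 f d⟩

/-- Back-and-forth classes of rank less than `α` are open in `t^x_α`: on `B_α(x, ∅)` each of them
is represented by a point of the orbit of `x`. -/
lemma isOpen_class (hA : IsTopologicalBasis (range A)) (hα : 0 < α) {γ : Ordinal.{0}}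
    (h0 : 0 < γ) (hγ : γ < α) (a : Finset ℕ) (z : X) :
    IsOpen {y : AlphaSpace G A x α | BackForth G γ a z y.val} := by
  rw [isOpen_iff_mem_nhds]
  intro y hy
  obtain ⟨f, hf⟩ := (y.backForth hA hα).exists_smul h0 hγ a
  have hmem : ∀ w : AlphaSpace G A x α,
      w.val ∈ alphaSet G A x γ (restrict f (f⁻¹ • a)) ↔ BackForth G γ a (f • x) w.val := by
    intro w
    rw [mem_alphaSet_iff hA h0, smul_inv_smul]
  have hfam : alphaSet G A x γ (restrict f (f⁻¹ • a)) ∈ earlierFamily G A x α := by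
    refine mem_iUnion₂.2 ⟨γ, hγ, ?_⟩
    rw [levelFamily, if_neg h0.ne']
    exact ⟨_, ⟨f, f.2, _, rfl⟩, rfl⟩
  refine mem_of_superset ((isOpen_preimage hfam).mem_nhds ((hmem y).2 hf)) fun w hw => ?_
  exact BackForth.trans hy (hf.symm.trans ((hmem w).1 hw))

lemma continuous_iff (hA : IsTopologicalBasis (range A)) (hα : 0 < α) {W : Type*}
    [TopologicalSpace W] {F : W → AlphaSpace G A x α} :
    Continuous F ↔ Continuous (fun w => (F w).val) ∧
      ∀ γ : Ordinal.{0}, 0 < γ → γ < α → ∀ a z, IsOpen {w | BackForth G γ a z (F w).val} := by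
  constructor
  · exact fun h => ⟨(continuous_val hA hα).comp h,
      fun γ h0 hγ a z => (isOpen_class hA hα h0 hγ a z).preimage h⟩
  · rintro ⟨hval, hcl⟩
    refine continuous_induced_rng.2 (continuous_generateFrom_iff.2 fun S hS => ?_)
    rcases earlierFamily_subset hA hS with hS | ⟨γ, h0, hγ, a, z, rfl⟩
    · exact hS.preimage hval
    · exact hcl γ h0 hγ a z

/-- Neighbourhoods in `t^x_α` are controlled by an open set of `X` and a single back-and-forth
class of rank less than `α`. The rank `0` stands for no condition. -/
lemma exists_subset_of_isOpen (hA : IsTopologicalBasis (range A)) {U : Set (AlphaSpace G A x α)}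
    (hα : 0 < α) (hU : IsOpen U) {y : AlphaSpace G A x α} (hy : y ∈ U) :
    ∃ (O : Set X) (γ : Ordinal.{0}) (a : Finset ℕ), IsOpen O ∧ y.val ∈ O ∧ γ < α ∧
      ∀ w : AlphaSpace G A x α, w.val ∈ O → (0 < γ → BackForth G γ a y.val w.val) → w ∈ U := by
  obtain ⟨W, hW, rfl⟩ := hU
  change GenerateOpen _ W at hW
  induction hW with
  | basic S hS =>
    rcases earlierFamily_subset hA hS with hS | ⟨γ, h0, hγ, a, z, rfl⟩
    · exact ⟨S, 0, ∅, hS, hy, hα, fun w hw _ => hw⟩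
    · exact ⟨univ, γ, a, isOpen_univ, mem_univ _, hγ, fun w _ hw => BackForth.trans hy (hw h0)⟩
  | univ => exact ⟨univ, 0, ∅, isOpen_univ, mem_univ _, hα, fun w _ _ => mem_univ _⟩
  | inter S T _ _ ihS ihT =>
    obtain ⟨O, γ, a, hO, hyO, hγ, h⟩ := ihS hy.1
    obtain ⟨O', γ', a', hO', hyO', hγ', h'⟩ := ihT hy.2
    refine ⟨O ∩ O', max γ γ', a ∪ a', hO.inter hO', ⟨hyO, hyO'⟩, max_lt hγ hγ',
      fun w hw hbf => ⟨h w hw.1 fun h0 => ?_, h' w hw.2 fun h0 => ?_⟩⟩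
    · exact ((hbf (lt_max_of_lt_left h0)).mono (le_max_left _ _)).anti Finset.subset_union_left
    · exact ((hbf (lt_max_of_lt_right h0)).mono (le_max_right _ _)).anti
        Finset.subset_union_right
  | sUnion K _ ih =>
    obtain ⟨S, hS, hyS⟩ := hy
    obtain ⟨O, γ, a, hO, hyO, hγ, h⟩ := ih S hS hyS
    exact ⟨O, γ, a, hO, hyO, hγ, fun w hw hbf => ⟨S, hS, h w hw hbf⟩⟩

lemma dense_orbit (hA : IsTopologicalBasis (range A)) (hα : 0 < α) :
    Dense {y : AlphaSpace G A x α | y.val ∈ MulAction.orbit G x} := by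
  rw [dense_iff_inter_open]
  rintro U hU ⟨y, hy⟩
  obtain ⟨O, γ, a, hO, hyO, hγ, h⟩ := exists_subset_of_isOpen hA hα hU hy
  have hxy := y.backForth hA hα
  have hex : ∃ g : G, g • x ∈ O ∧ (0 < γ → BackForth G γ a y.val (g • x)) := by
    rcases eq_or_ne γ 0 with rfl | h0
    · obtain ⟨g, -, hg⟩ := (hxy.meets_iff hO).2 ⟨1, one_mem _, by rwa [one_smul]⟩
      exact ⟨g, hg, fun h => absurd h (lt_irrefl _)⟩
    · obtain ⟨f, hf⟩ := hxy.exists_smul (pos_iff_ne_zero.2 h0) hγ a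
      obtain ⟨g, hg, hgO⟩ := (hf.meets_iff hO).2 ⟨1, one_mem _, by rwa [one_smul]⟩
      refine ⟨g * f, by rwa [mul_smul], fun _ => ?_⟩
      rw [mul_smul]
      exact hf.symm.smul_right_of_mem hg
  obtain ⟨g, hgO, hg⟩ := hex
  exact ⟨⟨g • x, orbit_subset_alphaSet G A x α (MulAction.mem_orbit x g)⟩, h _ hgO hg,
    MulAction.mem_orbit x g⟩

end AlphaSpace

end

/-! ### The topology `t^x_α` is Polish -/

section

variable {G : Subgroup (Equiv.Perm ℕ)} {X : Type*} [MulAction G X]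

lemma countable_Iio_of_lt_omega_one {α : Ordinal.{0}} (hα : α < Ordinal.omega 1) :
    (Iio α).Countable := by
  rw [← Cardinal.le_aleph0_iff_set_countable, Cardinal.mk_Iio_ordinal, Cardinal.lift_le_aleph0,
    ← Order.lt_succ_iff, Cardinal.succ_aleph0, ← Cardinal.lt_ord, Cardinal.ord_aleph]
  exact hα

/-- The index set of the codes: a positive rank less than `α` and a finite set. -/
abbrev CodeIndex (α : Ordinal.{0}) : Type _ := {γ : Ordinal.{0} // 0 < γ ∧ γ < α} × Finset ℕ

lemma countable_codeIndex {α : Ordinal.{0}} (hα : α < Ordinal.omega 1) :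
    Countable (CodeIndex α) := by
  have : Countable {γ : Ordinal.{0} // 0 < γ ∧ γ < α} :=
    ((countable_Iio_of_lt_omega_one hα).mono fun γ (hγ : 0 < γ ∧ γ < α) => hγ.2).to_subtype
  infer_instance

variable [TopologicalSpace X]

lemma isGδ_backForth_one [PolishSpace X] [ContinuousConstSMul G X] {A : ℕ → Set X}
    (hA : IsTopologicalBasis (range A)) (c : Finset ℕ) (z : X) :
    IsGδ {y : X | BackForth G 1 c z y} := by
  simp only [backForth_one_iff hA, ofPred_forall]
  refine IsGδ.iInter fun l => ?_
  have hopen : IsOpen {y : X | ∃ g ∈ fixer G c, g • y ∈ A l} := by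
    have : {y : X | ∃ g ∈ fixer G c, g • y ∈ A l} =
        ⋃ g ∈ fixer G c, (g • · : X → X) ⁻¹' A l := by
      ext y
      simp
    rw [this]
    exact isOpen_biUnion fun g _ =>
      (hA.isOpen (mem_range_self l)).preimage (continuous_const_smul g)
  by_cases hz : ∃ g ∈ fixer G c, g • z ∈ A l
  · simpa only [hz, true_iff] using hopen.isGδ
  · simp only [hz, false_iff]
    exact hopen.isClosed_compl.isGδ

variable [ContinuousConstSMul G X] [PolishSpace G] {α : Ordinal.{0}}

variable (G) in
/-- The code of `y` at `(γ, a)`: the first `n` such that `y` is equivalent, of rank `γ` over `a`,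
to `g_n x`, where `(g_n)` is a fixed dense sequence in `G`. It is only meaningful if `y` is
equivalent to `x` of rank `α`, and `0` is a junk value for points without such an `n`. -/
def code (x y : X) (j : CodeIndex α) : ℕ :=
  sInf {n | BackForth G j.1 j.2 (denseSeq G n • x) y}

lemma BackForth.exists_denseSeq {γ : Ordinal.{0}} {a : Finset ℕ} {x y : X} {g : G}
    (h : BackForth G γ a (g • x) y) : ∃ n, BackForth G γ a (denseSeq G n • x) y := by
  obtain ⟨_, hv, n, rfl⟩ := (denseRange_denseSeq G).inter_open_nonempty _
    ((isOpen_fixer a).preimage (continuous_mul_const g⁻¹)) ⟨g, by simp⟩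
  have := h.smul_left_of_mem hv
  exact ⟨n, by simpa [smul_smul] using this⟩

lemma BackForth.code_spec {x y : X} (hxy : BackForth G α ∅ x y) (j : CodeIndex α) :
    BackForth G j.1 j.2 (denseSeq G (code G x y j) • x) y :=
  let ⟨_, hg⟩ := hxy.exists_smul j.1.2.1 j.1.2.2 j.2
  Nat.sInf_mem (s := {n | BackForth G j.1 j.2 (denseSeq G n • x) y}) hg.exists_denseSeq

lemma BackForth.code_eq {x y z : X} {j : CodeIndex α} (h : BackForth G j.1 j.2 y z) :
    code G x y j = code G x z j := by
  unfold code
  congr 1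
  ext n
  exact ⟨fun h' => BackForth.trans h' h, fun h' => BackForth.trans h' h.symm⟩

variable (G) in
/-- The consistent pairs of a point `y` and a sequence of codes `e`: the codes are least possible
(`minimal`), `y` has rank `1` classes as prescribed by them (`base`), and the prescribed classes
satisfy the back-and-forth conditions among each other (`forth`, `back`) and with respect to `x`
(`base_bot`, `back_bot`). Apart from the rank `1` conditions, these only concern `e`. -/
structure Consistent (x : X) (p : X × (CodeIndex α → ℕ)) : Prop where
  minimal : ∀ j : CodeIndex α, code G x (denseSeq G (p.2 j) • x) j = p.2 j
  base_bot : BackForth G 1 ∅ x p.1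
  back_bot : ∀ j : CodeIndex α, ∃ g : G, BackForth G j.1 (g • j.2) (g • x)
    (denseSeq G (p.2 (j.1, g • j.2)) • x)
  base : ∀ j : CodeIndex α, BackForth G 1 j.2 (denseSeq G (p.2 j) • x) p.1
  forth : ∀ i j : CodeIndex α, i.1 < j.1 → j.2 ⊆ i.2 → ∃ g ∈ fixer G j.2,
    BackForth G i.1 i.2 (g • denseSeq G (p.2 j) • x) (denseSeq G (p.2 i) • x)
  back : ∀ i j : CodeIndex α, i.1 < j.1 → j.2 ⊆ i.2 → ∃ g ∈ fixer G j.2,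
    BackForth G i.1 (g • i.2) (g • denseSeq G (p.2 j) • x)
      (denseSeq G (p.2 (i.1, g • i.2)) • x)

lemma Consistent.backForth {x : X} {p : X × (CodeIndex α → ℕ)} (hp : Consistent G x p)
    (j : CodeIndex α) : BackForth G j.1 j.2 (denseSeq G (p.2 j) • x) p.1 := by
  have key : ∀ γ : Ordinal.{0}, ∀ j : CodeIndex α, (j.1 : Ordinal.{0}) = γ →
      BackForth G j.1 j.2 (denseSeq G (p.2 j) • x) p.1 := by
    intro γ
    induction γ using WellFoundedLT.induction with
    | ind γ ih =>
      rintro j rfl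
      rw [BackForth]
      refine ⟨fun U hU => (hp.base j).meets_iff hU, fun δ h0 hδ b hb => ?_⟩
      let i : CodeIndex α := (⟨δ, h0, hδ.trans j.1.2.2⟩, b)
      constructor
      · obtain ⟨g, hg, h⟩ := hp.forth i j hδ hb
        exact ⟨g, hg, h.trans (ih δ hδ i rfl)⟩
      · obtain ⟨g, hg, h⟩ := hp.back i j hδ hb
        have := (h.trans (ih δ hδ (i.1, g • i.2) rfl)).smul g⁻¹
        rw [inv_smul_smul, inv_smul_smul] at this
        exact ⟨g⁻¹, inv_mem hg, this⟩
  exact key _ j rfl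

lemma Consistent.backForth_bot {x : X} {p : X × (CodeIndex α → ℕ)} (hp : Consistent G x p) :
    BackForth G α ∅ x p.1 := by
  rw [BackForth]
  refine ⟨fun U hU => hp.base_bot.meets_iff hU, fun γ h0 hγ b _ => ?_⟩
  let j : CodeIndex α := (⟨γ, h0, hγ⟩, b)
  refine ⟨⟨_, mem_fixer_empty _, hp.backForth j⟩, ?_⟩
  obtain ⟨g, h⟩ := hp.back_bot j
  have := (h.trans (hp.backForth (j.1, g • j.2))).smul g⁻¹
  rw [inv_smul_smul, inv_smul_smul] at this
  exact ⟨g⁻¹, mem_fixer_empty _, this⟩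

lemma Consistent.code_eq {x : X} {p : X × (CodeIndex α → ℕ)} (hp : Consistent G x p) :
    code G x p.1 = p.2 :=
  funext fun j => ((hp.backForth j).code_eq).symm.trans (hp.minimal j)

lemma BackForth.consistent (hα : 0 < α) {x y : X} (hxy : BackForth G α ∅ x y) :
    Consistent G x (y, (code G x y : CodeIndex α → ℕ)) where
  minimal j := (hxy.code_spec j).code_eq
  base_bot := hxy.mono (Order.one_le_iff_pos.2 hα)
  back_bot j := by
    obtain ⟨g, -, hg⟩ := hxy.back j.1.2.1 j.1.2.2 (Finset.empty_subset j.2)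
    have := hg.smul g⁻¹
    rw [inv_smul_smul] at this
    exact ⟨g⁻¹, this.trans (hxy.code_spec (j.1, g⁻¹ • j.2)).symm⟩
  base j := (hxy.code_spec j).mono (Order.one_le_iff_pos.2 j.1.2.1)
  forth i j hij hsub := by
    obtain ⟨g, hg, h⟩ := (hxy.code_spec j).forth i.1.2.1 hij hsub
    exact ⟨g, hg, h.trans (hxy.code_spec i).symm⟩
  back i j hij hsub := by
    obtain ⟨g, hg, h⟩ := (hxy.code_spec j).back i.1.2.1 hij hsub
    have := h.smul g⁻¹
    rw [inv_smul_smul] at this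
    exact ⟨g⁻¹, inv_mem hg, this.trans (hxy.code_spec (i.1, g⁻¹ • i.2)).symm⟩

lemma isOpen_code_pred {Y : Type*} [TopologicalSpace Y] (j : CodeIndex α) (P : ℕ → Prop) :
    IsOpen {p : Y × (CodeIndex α → ℕ) | P (p.2 j)} :=
  (isOpen_discrete {n | P n}).preimage ((continuous_apply j).comp continuous_snd)

lemma isOpen_code_rel {Y : Type*} [TopologicalSpace Y] (i j : CodeIndex α) (P : ℕ → ℕ → Prop) :
    IsOpen {p : Y × (CodeIndex α → ℕ) | P (p.2 i) (p.2 j)} := by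
  have hc : Continuous fun p : Y × (CodeIndex α → ℕ) => (p.2 i, p.2 j) :=
    ((continuous_apply i).comp continuous_snd).prodMk ((continuous_apply j).comp continuous_snd)
  exact (isOpen_discrete {n : ℕ × ℕ | P n.1 n.2}).preimage hc

lemma isGδ_consistent [PolishSpace X] {A : ℕ → Set X} (hA : IsTopologicalBasis (range A))
    (hα : α < Ordinal.omega 1) (x : X) :
    IsGδ {p : X × (CodeIndex α → ℕ) | Consistent G x p} := by
  have hJ := countable_codeIndex hα
  have hiff : ∀ p : X × (CodeIndex α → ℕ), Consistent G x p ↔ _ :=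
    fun p => ⟨fun h => And.intro h.minimal (And.intro h.base_bot (And.intro h.back_bot
      (And.intro h.base (And.intro h.forth h.back)))),
      fun ⟨h1, h2, h3, h4, h5, h6⟩ => ⟨h1, h2, h3, h4, h5, h6⟩⟩
  simp only [hiff, ofPred_and, ofPred_forall]
  refine IsGδ.inter ?_ (IsGδ.inter ?_ (IsGδ.inter ?_ (IsGδ.inter ?_ (IsGδ.inter ?_ ?_))))
  · exact IsGδ.iInter fun j =>
      (isOpen_code_pred j fun n => code G x (denseSeq G n • x) j = n).isGδ
  · exact (isGδ_backForth_one hA ∅ x).preimage continuous_fst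
  · refine IsGδ.iInter fun j => IsOpen.isGδ ?_
    rw [ofPred_exists]
    exact isOpen_iUnion fun g => isOpen_code_pred (j.1, g • j.2) fun n =>
      BackForth G j.1 (g • j.2) (g • x) (denseSeq G n • x)
  · refine IsGδ.iInter fun j => ?_
    have : {p : X × (CodeIndex α → ℕ) | BackForth G 1 j.2 (denseSeq G (p.2 j) • x) p.1} =
        ⋂ n, ({p : X × (CodeIndex α → ℕ) | p.2 j ≠ n} ∪ Prod.fst ⁻¹' {y | BackForth G 1 j.2 (denseSeq G n • x) y}) := by
      ext p
      simp only [mem_iInter]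
      constructor
      · intro h n
        by_cases hn : p.2 j = n
        · exact Or.inr (by simpa [← hn] using h)
        · exact Or.inl hn
      · exact fun h => (h (p.2 j)).resolve_left fun h' => h' rfl
    rw [this]
    exact IsGδ.iInter fun n => (isOpen_code_pred j (· ≠ n)).isGδ.union
      ((isGδ_backForth_one hA j.2 _).preimage continuous_fst)
  · refine IsGδ.iInter fun i => IsGδ.iInter fun j => IsGδ.iInter fun _ => IsGδ.iInter fun _ =>
      IsOpen.isGδ ?_
    exact isOpen_code_rel i j fun m n => ∃ g ∈ fixer G j.2,
      BackForth G i.1 i.2 (g • denseSeq G n • x) (denseSeq G m • x)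
  · refine IsGδ.iInter fun i => IsGδ.iInter fun j => IsGδ.iInter fun _ => IsGδ.iInter fun _ =>
      IsOpen.isGδ ?_
    rw [ofPred_exists]
    refine isOpen_iUnion fun g => ?_
    exact isOpen_code_rel (i.1, g • i.2) j fun m n => g ∈ fixer G j.2 ∧
      BackForth G i.1 (g • i.2) (g • denseSeq G n • x) (denseSeq G m • x)

namespace AlphaSpace

variable {A : ℕ → Set X} {x : X}

/-- A point of `B_α(x, ∅)` together with its codes. -/
def withCode (y : AlphaSpace G A x α) : X × (CodeIndex α → ℕ) := (y.val, code G x y.val)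

lemma range_withCode (hA : IsTopologicalBasis (range A)) (hα : 0 < α) :
    range (withCode : AlphaSpace G A x α → _) = {p | Consistent G x p} := by
  ext p
  constructor
  · rintro ⟨y, rfl⟩
    exact (y.backForth hA hα).consistent hα
  · intro (hp : Consistent G x p)
    exact ⟨⟨p.1, (mem_alphaSet_bot_iff hA hα).2 hp.backForth_bot⟩, Prod.ext rfl hp.code_eq⟩

/-- The topology `t^x_α` is the one for which `B_α(x, ∅)` embeds into `X × ℕ^J`
by the codes, where `J` is the index set of the codes. -/
lemma isEmbedding_withCode (hA : IsTopologicalBasis (range A)) (hα : 0 < α) :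
    IsEmbedding (withCode : AlphaSpace G A x α → _) := by
  refine ⟨⟨le_antisymm ?_ ?_⟩, fun y z h => val_injective (congrArg Prod.fst h)⟩
  · rw [← continuous_iff_le_induced]
    refine (continuous_val hA hα).prodMk
      (continuous_pi fun j => continuous_discrete_rng.2 fun n => ?_)
    rw [isOpen_iff_mem_nhds]
    intro y hy
    refine mem_of_superset
      ((isOpen_class hA hα j.1.2.1 j.1.2.2 j.2 y.val).mem_nhds (BackForth.refl _ _ _)) ?_
    intro z hz
    exact (BackForth.code_eq (BackForth.symm hz)).trans hy
  · rw [← continuous_id_iff_le]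
    let t : TopologicalSpace (AlphaSpace G A x α) := induced withCode inferInstance
    have hw : Continuous[t, _] (withCode : AlphaSpace G A x α → X × (CodeIndex α → ℕ)) :=
      continuous_induced_dom
    refine (@continuous_iff _ _ _ _ _ _ _ _ hA hα _ t _).2 ⟨?_, ?_⟩
    · exact continuous_fst.comp hw
    · intro γ h0 hγ a z
      have hO := isOpen_code_pred (Y := X) (⟨⟨γ, h0, hγ⟩, a⟩ : CodeIndex α)
        fun n => BackForth G γ a z (denseSeq G n • x)
      convert hO.preimage hw using 1
      ext y
      have hy := (y.backForth hA hα).code_spec (⟨⟨γ, h0, hγ⟩, a⟩ : CodeIndex α)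
      exact ⟨fun h => BackForth.trans h hy.symm, fun h => BackForth.trans h hy⟩

theorem polishSpace [PolishSpace X] (hA : IsTopologicalBasis (range A)) (hα : 0 < α)
    (hα' : α < Ordinal.omega 1) : PolishSpace (AlphaSpace G A x α) := by
  have := countable_codeIndex hα'
  refine polishSpace_of_isEmbedding_of_isGδ_range (isEmbedding_withCode hA hα) ?_
  rw [range_withCode hA hα]
  exact isGδ_consistent hA hα' x

end AlphaSpace

end

/-! ### Orbits in the topology `t^x_α` -/

section

variable {G : Subgroup (Equiv.Perm ℕ)} {X : Type*} [MulAction G X]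
  {A : ℕ → Set X} {x : X} {α : Ordinal.{0}}

namespace AlphaSpace

variable [TopologicalSpace X] [ContinuousSMul G X] [PolishSpace G]

/-- On `B_α(x, ∅)` the Vaught transforms of `𝚺⁰_β` sets with `β ≤ α` are open in `t^x_α`: those
with `β < α` are unions of back-and-forth classes of rank `β`, and those with `β = α` are unions of
complements of such transforms. -/
lemma isOpen_vaught (hA : IsTopologicalBasis (range A)) (hα : 0 < α) {β : Ordinal.{0}}
    (hβ : β ≤ α) {D : Set X} (hD : IsSigma0 β D) (a : Finset ℕ) (k : G) :
    IsOpen {y : AlphaSpace G A x α | ¬ MeagrelyMeets G a D (k • y.val)} := by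
  cases hD with
  | of_isOpen _ hD =>
    simp only [not_meagrelyMeets_iff_of_isOpen hD, ofPred_exists, ofPred_and]
    refine isOpen_iUnion fun g => isOpen_const.inter ?_
    exact hD.preimage ((continuous_const_smul g).comp
      ((continuous_const_smul k).comp (continuous_val hA hα)))
  | iUnion _ hβ1 γ hγ S hS =>
    let : MeasurableSpace X := borel X
    have : BorelSpace X := ⟨rfl⟩
    have hm : ∀ n, MeasurableSet (S n) := fun n => (hS n).measurableSet.of_compl
    have hiff : ∀ n (z : X), ¬ MeagrelyMeets G a (S n) z ↔ _ :=
      fun n z => not_meagrelyMeets_iff (hm n)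
    simp only [meagrelyMeets_iUnion, not_forall, hiff, ofPred_exists, ofPred_and]
    refine isOpen_iUnion fun n => isOpen_iUnion fun b => isOpen_const.inter
      (isOpen_iUnion fun h => isOpen_const.inter ?_)
    rw [isOpen_iff_mem_nhds]
    intro y hy
    have h0 : 0 < γ n := zero_lt_one.trans_le (hγ n).1
    refine mem_of_superset ((isOpen_class hA hα h0 ((hγ n).2.trans_le hβ)
      ((h * k)⁻¹ • b) y.val).mem_nhds (BackForth.refl _ _ _)) ?_
    intro z (hz : BackForth G (γ n) ((h * k)⁻¹ • b) y.val z.val)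
    have hz' := hz.smul (h * k)
    rw [smul_inv_smul, mul_smul, mul_smul] at hz'
    exact (hz'.meagrelyMeets_iff (hS n)).1 hy

lemma isGδ_orbit (hA : IsTopologicalBasis (range A)) (hα : 0 < α)
    (hx : IsPi0 (α + 1) (MulAction.orbit G x)) :
    IsGδ {y : AlphaSpace G A x α | y.val ∈ MulAction.orbit G x} := by
  let : MeasurableSpace X := borel X
  have : BorelSpace X := ⟨rfl⟩
  obtain ⟨β, S, hβ, hS, hSx⟩ : ∃ (β : ℕ → Ordinal.{0}) (S : ℕ → Set X), (∀ n, β n ≤ α) ∧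
      (∀ n, IsSigma0 (β n) (S n)ᶜ) ∧ (MulAction.orbit G x)ᶜ = ⋃ n, S n := by
    unfold IsPi0 at hx
    generalize hγ : α + 1 = γ at hx
    generalize hC : (MulAction.orbit G x)ᶜ = C at hx
    cases hx with
    | of_isOpen => exact absurd hγ ((Order.one_le_iff_pos.2 hα).trans_lt (lt_add_one α)).ne'
    | iUnion _ _ β hβ S hS =>
      exact ⟨β, S, fun n => Order.lt_add_one_iff.1 (hγ ▸ (hβ n).2), hS, rfl⟩
  have hm : ∀ n, MeasurableSet (S n) := fun n => (hS n).measurableSet.of_compl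
  -- Membership in the orbit is a countable conjunction, because a translating group element may
  -- be taken from a countable dense set.
  have key : ∀ y : X, y ∈ MulAction.orbit G x ↔
      ∀ n (a : Finset ℕ) m, ¬ MeagrelyMeets G a (S n)ᶜ (denseSeq G m • y) := by
    intro y
    rw [← meagrelyMeets_compl_orbit_iff, hSx, meagrelyMeets_iUnion]
    refine forall_congr' fun n => ?_
    rw [← not_iff_not, not_meagrelyMeets_iff (hm n)]
    push Not
    constructor
    · rintro ⟨a, -, h, -, hmeag⟩
      obtain ⟨_, hv, m, rfl⟩ := (denseRange_denseSeq G).inter_open_nonempty _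
        ((isOpen_fixer a).preimage (continuous_mul_const h⁻¹)) ⟨h, by simp⟩
      exact ⟨a, m, by simpa [smul_smul] using hmeag.smul_of_mem hv⟩
    · rintro ⟨a, m, hmeag⟩
      exact ⟨a, Finset.empty_subset a, _, mem_fixer_empty _, hmeag⟩
  simp only [key, ofPred_forall]
  exact IsGδ.iInter fun n => IsGδ.iInter fun a => IsGδ.iInter fun m =>
    (isOpen_vaught hA hα (hβ n) (hS n) a _).isGδ

theorem not_isMeagre_orbit [PolishSpace X] (hA : IsTopologicalBasis (range A)) (hα : 0 < α)
    (hα' : α < Ordinal.omega 1) (hx : IsPi0 (α + 1) (MulAction.orbit G x)) :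
    ¬ IsMeagre {y : AlphaSpace G A x α | y.val ∈ MulAction.orbit G x} := by
  have := polishSpace (G := G) (x := x) hA hα hα'
  have : Nonempty (AlphaSpace G A x α) :=
    ⟨⟨x, orbit_subset_alphaSet G A x α (MulAction.mem_orbit_self x)⟩⟩
  exact not_isMeagre_of_isGδ_of_dense (isGδ_orbit hA hα hx) (dense_orbit hA hα)

end AlphaSpace

variable (G) in
/-- The orbit of `x` as a type of its own, carrying the topology induced by `t^x_α`. -/
def OrbitSpace (_A : ℕ → Set X) (x : X) (_α : Ordinal.{0}) : Type _ := MulAction.orbit G x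

namespace OrbitSpace

instance : TopologicalSpace (OrbitSpace G A x α) := orbitTopology G A x α

instance : MulAction G (OrbitSpace G A x α) :=
  inferInstanceAs (MulAction G (MulAction.orbit G x))

instance : MulAction.IsPretransitive G (OrbitSpace G A x α) :=
  inferInstanceAs (MulAction.IsPretransitive G (MulAction.orbit G x))

/-- The point `x` of its own orbit. -/
def basePoint : OrbitSpace G A x α := ⟨x, MulAction.mem_orbit_self x⟩

/-- The inclusion of the orbit of `x` into `B_α(x, ∅)`. -/
def toAlphaSpace : OrbitSpace G A x α → AlphaSpace G A x α :=
  inclusion (orbit_subset_alphaSet G A x α)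

lemma isEmbedding_toAlphaSpace :
    IsEmbedding (toAlphaSpace : OrbitSpace G A x α → AlphaSpace G A x α) :=
  ⟨⟨rfl⟩, inclusion_injective (orbit_subset_alphaSet G A x α)⟩

lemma range_toAlphaSpace : range (toAlphaSpace : OrbitSpace G A x α → AlphaSpace G A x α) =
    {y | y.val ∈ MulAction.orbit G x} := by
  ext y
  exact ⟨fun ⟨z, hz⟩ => hz ▸ z.2, fun hy => ⟨⟨y.val, hy⟩, rfl⟩⟩

variable [TopologicalSpace X]

lemma continuousConstSMul [ContinuousConstSMul G X] (hA : IsTopologicalBasis (range A))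
    (hα : 0 < α) : ContinuousConstSMul G (OrbitSpace G A x α) where
  continuous_const_smul g := by
    have hι := (isEmbedding_toAlphaSpace (G := G) (A := A) (x := x) (α := α)).continuous
    rw [isEmbedding_toAlphaSpace.continuous_iff, AlphaSpace.continuous_iff hA hα]
    refine ⟨(continuous_const_smul g).comp ((AlphaSpace.continuous_val hA hα).comp hι), ?_⟩
    intro γ h0 hγ a z
    convert (AlphaSpace.isOpen_class hA hα h0 hγ (g⁻¹ • a) (g⁻¹ • z)).preimage hι using 1
    ext y
    change BackForth G γ a z (g • (toAlphaSpace y).val) ↔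
      BackForth G γ (g⁻¹ • a) (g⁻¹ • z) (toAlphaSpace y).val
    rw [← BackForth.smul_iff g⁻¹, inv_smul_smul]

lemma continuous_smul_const [ContinuousSMul G X] (hA : IsTopologicalBasis (range A))
    (hα : 0 < α) (y : OrbitSpace G A x α) : Continuous fun g : G => g • y := by
  rw [isEmbedding_toAlphaSpace.continuous_iff, AlphaSpace.continuous_iff hA hα]
  refine ⟨continuous_id.smul continuous_const, fun γ h0 hγ a z => ?_⟩
  rw [isOpen_iff_mem_nhds]
  intro g hg
  refine mem_of_superset (((isOpen_fixer a).preimage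
    (continuous_mul_const g⁻¹)).mem_nhds (by simp)) fun h hh => ?_
  have := BackForth.smul_right_of_mem (y := g • (toAlphaSpace y).val) hh hg
  rwa [smul_smul, inv_mul_cancel_right] at this

/-- Effros' theorem applies to the orbit, a `G_δ` subset of a Polish space. -/
theorem isOpenMap_orbitMap [PolishSpace X] [ContinuousSMul G X] [PolishSpace G]
    (hA : IsTopologicalBasis (range A)) (hα : 0 < α) (hα' : α < Ordinal.omega 1)
    (hx : IsPi0 (α + 1) (MulAction.orbit G x)) :
    IsOpenMap (fun g : G => g • (basePoint : OrbitSpace G A x α)) := by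
  have := AlphaSpace.polishSpace (G := G) (x := x) hA hα hα'
  have : PolishSpace (OrbitSpace G A x α) := by
    refine polishSpace_of_isEmbedding_of_isGδ_range isEmbedding_toAlphaSpace ?_
    rw [range_toAlphaSpace]
    exact AlphaSpace.isGδ_orbit hA hα hx
  have := continuousConstSMul (G := G) (x := x) hA hα
  intro U hU
  rw [isOpen_iff_mem_nhds]
  rintro _ ⟨g, hg, rfl⟩
  obtain ⟨a, -, ha⟩ := exists_coset_subset hU hg ∅
  refine mem_of_superset ((isOpen_orbit_of_isOpen (continuous_smul_const hA hα) (isOpen_fixer a)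
    _).mem_nhds (MulAction.mem_orbit_self _)) ?_
  rintro _ ⟨v, rfl⟩
  exact ⟨v * g, ha v v.2, mul_smul _ _ _⟩

end OrbitSpace

lemma IsPi0.add_one_of_isSuccLimit [TopologicalSpace X] {S : Set X}
    (hα : Order.IsSuccLimit α) (hS : IsPi0 α S) : IsPi0 (α + 1) S := by
  unfold IsPi0 at hS ⊢
  generalize Sᶜ = C at hS
  cases hS with
  | of_isOpen =>
    have := hα.add_one_lt hα.bot_lt
    simp at this
  | iUnion _ h1 β hβ S hS =>
    exact IsSigma0.iUnion _ (h1.trans (lt_add_one α)) β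
      (fun n => ⟨(hβ n).1, (hβ n).2.trans (lt_add_one α)⟩) S hS

lemma orbit_eq_alphaSet [TopologicalSpace X] [ContinuousSMul G X] [BaireSpace G]
    (hA : IsTopologicalBasis (range A)) (hα : 0 < α) (hx : IsPi0 α (MulAction.orbit G x)) :
    MulAction.orbit G x = alphaSet G A x α ⊥ :=
  (orbit_subset_alphaSet G A x α).antisymm fun _ hy =>
    ((mem_alphaSet_bot_iff hA hα).1 hy).mem_orbit hx

end

end AlphaSets

end

theorem proposition18
    (G : Subgroup (Equiv.Perm ℕ)) (hG : IsClosed (G : Set (Equiv.Perm ℕ)))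
    {X : Type*} [TopologicalSpace X] [PolishSpace X] [MulAction G X] [ContinuousSMul G X]
    (A : ℕ → Set X) (hA : TopologicalSpace.IsTopologicalBasis (Set.range A))
    (x : X) (α : Ordinal.{0}) (hα : 0 < α) (hα' : α < Ordinal.omega 1) :
    (AlphaSets.IsPi0 (α + 1) (MulAction.orbit G x) →
      ¬ @IsMeagre (AlphaSets.alphaSet G A x α ⊥) (AlphaSets.alphaTopology G A x α)
          {y | (y : X) ∈ MulAction.orbit G x} ∧
      @IsOpenMap G (MulAction.orbit G x) inferInstance (AlphaSets.orbitTopology G A x α)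
          (AlphaSets.orbitMap G x) ∧
      MulAction.orbit G x = AlphaSets.alphaSet G A x (α + 1) ⊥) ∧
    (Order.IsSuccLimit α → AlphaSets.IsPi0 α (MulAction.orbit G x) →
      MulAction.orbit G x = AlphaSets.alphaSet G A x α ⊥ ∧
      @IsOpenMap G (MulAction.orbit G x) inferInstance (AlphaSets.orbitTopology G A x α)
          (AlphaSets.orbitMap G x)) := by
  have hpol : PolishSpace G := hG.polishSpace
  refine ⟨fun hx => ⟨?_, ?_, ?_⟩, fun hlim hx => ⟨?_, ?_⟩⟩
  · exact AlphaSets.AlphaSpace.not_isMeagre_orbit hA hα hα' hx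
  · exact AlphaSets.OrbitSpace.isOpenMap_orbitMap hA hα hα' hx
  · exact AlphaSets.orbit_eq_alphaSet hA (hα.trans (lt_add_one α)) hx
  · exact AlphaSets.orbit_eq_alphaSet hA hα hx
  · exact AlphaSets.OrbitSpace.isOpenMap_orbitMap hA hα hα' (hx.add_one_of_isSuccLimit hlim)
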